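/- All representations are in complex Banach spaces. A representation $\rho$ of a topological group $G$ by bounded invertible linear operators on a Banach space $E$ is *strongly continuous* if $g\mapsto\rho_g x$ is continuous for every $x\in E$ (in particular, if $(g,x)\mapsto\rho_g x$ is jointly continuous); it is *irreducible* if $E\ne 0$ and $E$ has no closed invariant linear subspaces other than $0$ and $E$; it is *trivial* if $\rho_g=\mathrm{I}$ for all $g\in G$. A topological group is *monothetic* if it contains a dense cyclic subgroup; an abelian topological group is *minimally almost periodic* if it has no nontrivial continuous homomorphism to $\{z\in\mathbb C:|z|=1\}$. For a Hilbert space $\mathcal H$, the unitary group $U(\mathcal H)$ carries the strong operator topology and its subgroups the subspace topology. Let $\mathcal H$ be a separable infinite-dimensional complex Hilbert space. Then $U(\mathcal H)$ has a nontrivial subgroup $G$ that is monothetic and admits no nontrivial irreducible strongly continuous Banach representation. Moreover, examples are given by the following groups. (a) Let $(X,\mu)$ be a standard Borel space with a finite nonzero nonatomic measure, and let $L_1(X,\mathbb S^1)$ be the group of classes of measurable functions $X\to\mathbb S^1=\{z\in\mathbb C:|z|=1\}$ with the metric $d(f,g)=\int_X|f-g|\,d\mu$. Then $L_2(X)$ is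 separable and infinite-dimensional, the representation of $L_1(X,\mathbb S^1)$ on $L_2(X)$ by multiplication operators is an isomorphism of topological groups onto a subgroup of $U(L_2(X))$, and this subgroup is nontrivial, monothetic, and admits no nontrivial irreducible strongly continuous Banach representation. (b) Let $1\le p<\infty$ and let $D$ be a discrete subgroup of the real Banach space $\ell_p$ such that the Banach–Lie group $\ell_p/D$ is minimally almost periodic. Then $\ell_p/D$ is monothetic, and for every faithful strongly continuous unitary representation $\pi$ of $\ell_p/D$ on a separable Hilbert space, the subgroup $\pi(\ell_p/D)$ of the unitary group is nontrivial, monothetic, and admits no nontrivial irreducible strongly continuous Banach representation. (c) For every $p$ with $1\le p<\infty$ there is a discrete subgroup $D$ of $\ell_p$ such that $\ell_p/D$ is minimally almost periodic and admits a faithful strongly continuous unitary representation on every separable infinite-dimensional Hilbert space. -/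

import Mathlib

open MeasureTheory
open scoped ENNReal

noncomputable section

/-- The strong operator topology on the unitary group `U(H)` of a complex Hilbert space.
The group `H ≃ₗᵢ[ℂ] H` of surjective linear isometries of `H` is the unitary group of `H`; it
gets the coarsest topology for which all maps `U ↦ U x`, `x : H`, are continuous. -/
instance strongOperatorTopology {H : Type*} [NormedAddCommGroup H] [InnerProductSpace ℂ H] :
    TopologicalSpace (H ≃ₗᵢ[ℂ] H) :=
  TopologicalSpace.induced (fun (U : H ≃ₗᵢ[ℂ] H) (x : H) => U x) inferInstance

/-- A topological group is monothetic if it contains an everywhere dense cyclic subgroup. -/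
def IsMonothetic (G : Type*) [Group G] [TopologicalSpace G] : Prop :=
  ∃ g : G, Dense (Subgroup.zpowers g : Set G)

/-- A topological abelian group is minimally almost periodic if it has no nontrivial continuous
characters. -/
def IsMinimallyAlmostPeriodic (G : Type*) [CommGroup G] [TopologicalSpace G] : Prop :=
  ∀ χ : G →* Circle, Continuous χ → χ = 1

/-- Strong continuity of a representation by bounded invertible operators: continuity into the
general linear group with the strong operator topology, that is, every orbit map `g ↦ ρ g x` is
continuous. It is implied by joint continuity of `(g, x) ↦ ρ g x`. -/
def IsStronglyContinuous {G : Type*} [Group G] [TopologicalSpace G]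
    {E : Type*} [NormedAddCommGroup E] [NormedSpace ℂ E] (ρ : G →* (E ≃L[ℂ] E)) : Prop :=
  ∀ x : E, Continuous fun g : G => ρ g x

/-- A representation in a Banach space `E` is (topologically) irreducible if `E ≠ 0` and the only
closed invariant linear subspaces are `0` and `E`. -/
def IsTopologicallyIrreducible {G : Type*} [Group G]
    {E : Type*} [NormedAddCommGroup E] [NormedSpace ℂ E] (ρ : G →* (E ≃L[ℂ] E)) : Prop :=
  Nontrivial E ∧
    ∀ F : Submodule ℂ E, IsClosed (F : Set E) → (∀ g : G, ∀ x ∈ F, ρ g x ∈ F) → F = ⊥ ∨ F = ⊤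

/-- `G` admits no nontrivial irreducible strongly continuous representation in a complex Banach
space: each such representation sends every group element to the identity operator. -/
def HasNoNontrivialIrreducibleBanachRep.{v, u} (G : Type u) [Group G] [TopologicalSpace G] :
    Prop :=
  ∀ (E : Type v) [NormedAddCommGroup E] [NormedSpace ℂ E] [CompleteSpace E]
    (ρ : G →* (E ≃L[ℂ] E)),
    IsStronglyContinuous ρ → IsTopologicallyIrreducible ρ → ρ = 1

/-- The group `L₁(X, S¹)` of (classes modulo null sets of) measurable functions from `X` to the
unit circle, with pointwise multiplication. -/
def L1Circle {X : Type*} [MeasurableSpace X] (μ : Measure X) : Type _ := X →ₘ[μ] Circle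

namespace L1Circle

variable {X : Type*} [MeasurableSpace X] {μ : Measure X}

instance : CommGroup (L1Circle μ) := inferInstanceAs (CommGroup (X →ₘ[μ] Circle))

/-- The underlying complex-valued function class. -/
def toComplex (f : L1Circle μ) : X →ₘ[μ] ℂ :=
  AEEqFun.comp (fun z : Circle => (z : ℂ)) continuous_subtype_val (f : X →ₘ[μ] Circle)

theorem toComplex_injective : Function.Injective (toComplex : L1Circle μ → X →ₘ[μ] ℂ) := by
  intro f g h
  apply AEEqFun.ext (μ := μ)
  have hf := AEEqFun.coeFn_comp (fun z : Circle => (z : ℂ)) continuous_subtype_val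
    (f : X →ₘ[μ] Circle)
  have hg := AEEqFun.coeFn_comp (fun z : Circle => (z : ℂ)) continuous_subtype_val
    (g : X →ₘ[μ] Circle)
  have h' : (toComplex f : X → ℂ) =ᵐ[μ] toComplex g := by rw [h]
  filter_upwards [hf, hg, h'] with x h1 h2 h3
  apply Circle.ext
  exact h1.symm.trans (h3.trans h2)

theorem norm_toComplex (f : L1Circle μ) : ∀ᵐ x ∂μ, ‖toComplex f x‖ = 1 := by
  filter_upwards [AEEqFun.coeFn_comp (fun z : Circle => (z : ℂ)) continuous_subtype_val
    (f : X →ₘ[μ] Circle)] with x h1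
  exact (congrArg norm h1).trans (Circle.norm_coe _)

theorem toComplex_mul (f g : L1Circle μ) : toComplex (f * g) = toComplex f * toComplex g := by
  apply AEEqFun.ext
  filter_upwards [AEEqFun.coeFn_comp (fun z : Circle => (z : ℂ)) continuous_subtype_val
      (f : X →ₘ[μ] Circle),
    AEEqFun.coeFn_comp (fun z : Circle => (z : ℂ)) continuous_subtype_val (g : X →ₘ[μ] Circle),
    AEEqFun.coeFn_comp (fun z : Circle => (z : ℂ)) continuous_subtype_val
      ((f * g : L1Circle μ) : X →ₘ[μ] Circle),
    AEEqFun.coeFn_mul (f : X →ₘ[μ] Circle) (g : X →ₘ[μ] Circle),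
    AEEqFun.coeFn_mul (toComplex f) (toComplex g)] with x h1 h2 h3 h4 h5
  rw [h5]
  refine h3.trans ((congrArg (fun z : Circle => (z : ℂ)) h4).trans ?_)
  refine (Circle.coe_mul _ _).trans ?_
  exact congrArg₂ (· * ·) h1.symm h2.symm

theorem toComplex_one : toComplex (1 : L1Circle μ) = 1 := by
  apply AEEqFun.ext
  filter_upwards [AEEqFun.coeFn_comp (fun z : Circle => (z : ℂ)) continuous_subtype_val
      ((1 : L1Circle μ) : X →ₘ[μ] Circle),
    AEEqFun.coeFn_one (μ := μ) (α := X) (β := Circle),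
    AEEqFun.coeFn_one (μ := μ) (α := X) (β := ℂ)] with x h1 h2 h3
  rw [h3]
  exact h1.trans ((congrArg (fun z : Circle => (z : ℂ)) h2).trans Circle.coe_one)

/-- On a finite measure space, unimodular functions are integrable. -/
def toLp [IsFiniteMeasure μ] (f : L1Circle μ) : Lp ℂ 1 μ :=
  ⟨toComplex f, Lp.mem_Lp_iff_memLp.2 <| MemLp.of_bound (toComplex f).aestronglyMeasurable 1 <| by
    filter_upwards [norm_toComplex f] with x hx using hx.le⟩

theorem toLp_injective [IsFiniteMeasure μ] :
    Function.Injective (toLp : L1Circle μ → Lp ℂ 1 μ) := fun _ _ h =>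
  toComplex_injective (congrArg Subtype.val h)

/-- The metric of `L₁(X, S¹)`, inherited from `L₁(X, ℂ)`. -/
instance [IsFiniteMeasure μ] : MetricSpace (L1Circle μ) :=
  MetricSpace.induced toLp toLp_injective inferInstance

/-- The distance is `d(f, g) = ∫ |f(x) - g(x)| dμ(x)`. -/
theorem dist_eq [IsFiniteMeasure μ] (f g : L1Circle μ) :
    dist f g = ∫ x, ‖toComplex f x - toComplex g x‖ ∂μ := by
  change dist (toLp f) (toLp g) = _
  rw [dist_eq_norm, L1.norm_eq_integral_norm]
  apply integral_congr_ae
  filter_upwards [Lp.coeFn_sub (toLp f) (toLp g)] with x hx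
  rw [hx]
  rfl

/-- The product of a unimodular function with an `L₂` function. -/
def mulLp (f : L1Circle μ) (φ : Lp ℂ 2 μ) : Lp ℂ 2 μ :=
  ⟨toComplex f * (φ : X →ₘ[μ] ℂ), Lp.mem_Lp_of_ae_le (g := φ) <| by
    filter_upwards [norm_toComplex f, AEEqFun.coeFn_mul (toComplex f) (φ : X →ₘ[μ] ℂ)]
      with x h1 h2
    rw [h2, Pi.mul_apply, norm_mul, h1, one_mul]⟩

theorem norm_mulLp (f : L1Circle μ) (φ : Lp ℂ 2 μ) : ‖mulLp f φ‖ = ‖φ‖ := by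
  rw [Lp.norm_def, Lp.norm_def]
  congr 1
  apply eLpNorm_congr_norm_ae
  filter_upwards [norm_toComplex f, AEEqFun.coeFn_mul (toComplex f) (φ : X →ₘ[μ] ℂ)] with x h1 h2
  refine (congrArg norm h2).trans ?_
  rw [Pi.mul_apply, norm_mul, h1, one_mul]

theorem mulLp_mul (f g : L1Circle μ) (φ : Lp ℂ 2 μ) :
    mulLp (f * g) φ = mulLp f (mulLp g φ) := by
  apply Subtype.ext
  change toComplex (f * g) * (φ : X →ₘ[μ] ℂ) = toComplex f * (toComplex g * (φ : X →ₘ[μ] ℂ))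
  rw [toComplex_mul, mul_assoc]

theorem mulLp_one (φ : Lp ℂ 2 μ) : mulLp (1 : L1Circle μ) φ = φ := by
  apply Subtype.ext
  change toComplex (1 : L1Circle μ) * (φ : X →ₘ[μ] ℂ) = φ
  rw [toComplex_one, one_mul]

/-- The unitary operator on `L₂(X)` of multiplication by a unimodular function. -/
def mulUnitary (f : L1Circle μ) : Lp ℂ 2 μ ≃ₗᵢ[ℂ] Lp ℂ 2 μ where
  toFun := mulLp f
  invFun := mulLp f⁻¹
  left_inv φ := by rw [← mulLp_mul, inv_mul_cancel, mulLp_one]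
  right_inv φ := by rw [← mulLp_mul, mul_inv_cancel, mulLp_one]
  map_add' φ ψ := by
    apply Lp.ext
    filter_upwards [AEEqFun.coeFn_mul (toComplex f) ((φ + ψ : Lp ℂ 2 μ) : X →ₘ[μ] ℂ),
      AEEqFun.coeFn_mul (toComplex f) (φ : X →ₘ[μ] ℂ),
      AEEqFun.coeFn_mul (toComplex f) (ψ : X →ₘ[μ] ℂ),
      Lp.coeFn_add φ ψ, Lp.coeFn_add (mulLp f φ) (mulLp f ψ)] with x h1 h2 h3 h4 h5
    rw [h5, Pi.add_apply]
    refine h1.trans ?_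
    refine Eq.trans ?_ (congrArg₂ (· + ·) h2.symm h3.symm)
    simp only [Pi.mul_apply, h4, Pi.add_apply, mul_add]
  map_smul' c φ := by
    apply Lp.ext
    filter_upwards [AEEqFun.coeFn_mul (toComplex f) ((c • φ : Lp ℂ 2 μ) : X →ₘ[μ] ℂ),
      AEEqFun.coeFn_mul (toComplex f) (φ : X →ₘ[μ] ℂ),
      Lp.coeFn_smul c φ, Lp.coeFn_smul c (mulLp f φ)] with x h1 h2 h3 h4
    rw [RingHom.id_apply, h4, Pi.smul_apply]
    refine h1.trans ?_
    refine Eq.trans ?_ (congrArg (c • ·) h2.symm)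
    simp only [Pi.mul_apply, h3, Pi.smul_apply, smul_eq_mul]
    ring
  norm_map' φ := norm_mulLp f φ

variable (μ) in
/-- The unitary representation of `L₁(X, S¹)` on `L₂(X)` by multiplication operators. -/
def mulRep : L1Circle μ →* (Lp ℂ 2 μ ≃ₗᵢ[ℂ] Lp ℂ 2 μ) where
  toFun := mulUnitary
  map_one' := LinearIsometryEquiv.ext mulLp_one
  map_mul' f g := LinearIsometryEquiv.ext (mulLp_mul f g)

theorem mulRep_apply (f : L1Circle μ) (φ : Lp ℂ 2 μ) :
    mulRep μ f φ =ᵐ[μ] fun x => toComplex f x * φ x :=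
  AEEqFun.coeFn_mul (toComplex f) (φ : X →ₘ[μ] ℂ)

end L1Circle

/-- The real sequence space `ℓ_p`. -/
abbrev RealLp (p : ℝ≥0∞) : Type := lp (fun _ : ℕ => ℝ) p

/-- The quotient `ℓ_p / D`, written multiplicatively, with the quotient topology. For discrete `D`
it is a connected abelian Banach-Lie group modelled over `ℓ_p`. -/
abbrev LpQuotient (p : ℝ≥0∞) [Fact (1 ≤ p)] (D : AddSubgroup (RealLp p)) : Type :=
  Multiplicative (RealLp p ⧸ D)

end

universe u v w

/-! Absence of irreducible representations. Let an abelian group act irreducibly and let `γ` be a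
circle subgroup. The Fourier coefficients of the orbits `t ↦ ρ (γ t) x` lie in the eigenspaces of
`γ`, which are closed and, by commutativity, invariant. They cannot all be zero, since then every
scalar function `ℓ (ρ (γ t) x)` would have zero Fourier series; so one of them is everything and `γ`
acts by a character. If the circle subgroups generate a dense subgroup, the whole group acts by
unimodular scalars, that is, by a continuous character, and minimal almost periodicity makes it
trivial (`hasNoNontrivialIrreducibleBanachRep_of_circles`). Monotheticity. By Baire category it
suffices that torsion is dense and that every element has roots arbitrarily close to the identity
(`isMonothetic_of_dense_torsion`). Both criteria apply to `L1Circle μ`, where step functions supply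
circles and torsion and nonatomicity kills characters, and to `E ⧸ D`, where the lines through `D`
become circles and span a dense subspace because there are no characters. Both conclusions pass to
continuous homomorphic images. Existence over `ℓ_p`. The subgroup `D` is the kernel of `x ↦ exp (2 π
i T x)` for a bounded random functional `T : ℓ_p → L_1(Ω)`. Hence `ℓ_p / D` maps injectively and
continuously to `L1Circle`, which acts faithfully on every separable infinite-dimensional Hilbert
space. The coordinates are grouped into windows, each a discrete cube of high dimension. The link
vectors of a window `W` are its normalized Rademacher vectors plus `1 / (W + 1)` times one unit
vector, its parent. A functional `f` integral on all link vectors is zero: on some Rademacher vector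
of `W` it is at most `‖f‖ / (W + 1) ^ 2`, so for large `W` the integer value on the link vector is
zero and the value at the parent is at most `‖f‖ / (W + 1)`; each coordinate is the parent of
infinitely many windows (`eq_zero_of_int_linkVector`). To make `T` integral on link vectors, its
coefficients on a window form a Riesz product whose Rademacher coefficients are random rounding
errors of mean zero. The product is nonnegative with mean one, so `T` is bounded, and outside a
prescribed root window its mean absolute value is at most `‖x‖ / 8`. Thus, for `x ∈ D` with `‖x‖ ≤
1`, each root functional is within `1 / 4` of an integer at `x`; countably many roots, mixed into
one `T`, force `x = 0` (`eq_zero_of_roots_near_int`), so `D` is discrete. -/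

/-! ### Irreducible representations and circle subgroups -/

section BanachRepresentations

variable {G : Type*} {E : Type*} [NormedAddCommGroup E] [NormedSpace ℂ E]

/-- The isotypic component of a circle subgroup under the character `fourier n`. -/
def circleEigenspace [Group G] (ρ : G →* (E ≃L[ℂ] E)) (γ : UnitAddCircle → G) (n : ℤ) :
    Submodule ℂ E where
  carrier := {x | ∀ t, ρ (γ t) x = fourier n t • x}
  zero_mem' := by simp
  add_mem' {x y} hx hy := fun t => by rw [map_add, hx t, hy t, smul_add]
  smul_mem' c x hx := fun t => by rw [map_smul, hx t, smul_comm]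

theorem isClosed_circleEigenspace [Group G] (ρ : G →* (E ≃L[ℂ] E)) (γ : UnitAddCircle → G)
    (n : ℤ) : IsClosed (circleEigenspace ρ γ n : Set E) := by
  have : (circleEigenspace ρ γ n : Set E) = ⋂ t, {x | ρ (γ t) x = fourier n t • x} := by
    ext x
    simp [circleEigenspace]
  rw [this]
  refine isClosed_iInter fun t => isClosed_eq (ρ (γ t)).continuous (by fun_prop)

/-- Applying `ρ (γ s)` under the integral translates the orbit by `s`; invariance of Haar measure
turns the translation into the factor `fourier n s`. -/
theorem fourierCoeff_orbit_mem_circleEigenspace [Group G] [TopologicalSpace G]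
    [CompleteSpace E]
    (ρ : G →* (E ≃L[ℂ] E)) (hρ : IsStronglyContinuous ρ) (γ : UnitAddCircle → G)
    (hγ : Continuous γ) (hadd : ∀ a b, γ (a + b) = γ a * γ b) (x : E) (n : ℤ) :
    fourierCoeff (fun t => ρ (γ t) x) n ∈ circleEigenspace ρ γ n := by
  intro s
  have hcont : Continuous fun t : UnitAddCircle => fourier (-n) t • ρ (γ t) x :=
    (map_continuous (fourier (-n))).smul ((hρ x).comp hγ)
  have hint : Integrable (fun t : UnitAddCircle => fourier (-n) t • ρ (γ t) x)
      AddCircle.haarAddCircle := hcont.integrable_of_hasCompactSupport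
        (HasCompactSupport.of_compactSpace _)
  have h1 := ((ρ (γ s) : E ≃L[ℂ] E) : E →L[ℂ] E).integral_comp_comm hint
  have h2 := integral_add_left_eq_self (μ := AddCircle.haarAddCircle (T := 1))
    (fun t : UnitAddCircle => fourier (-n) t • ρ (γ t) x) s
  unfold fourierCoeff
  refine h1.symm.trans ?_
  rw [← h2, ← integral_smul]
  refine integral_congr_ae (.of_forall fun t => ?_)
  have h3 : fourier n s * fourier (-n) s = 1 := by
    simp only [fourier_apply, neg_smul, AddCircle.toCircle_neg, ← Circle.coe_mul,
      mul_inv_cancel, Circle.coe_one]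
  simp only [ContinuousLinearEquiv.coe_coe, map_smul, hadd, map_mul]
  rw [smul_smul]
  have h4 : fourier (-n) (s + t) = fourier (-n) s * fourier (-n) t := by
    simp [fourier_apply, smul_add, AddCircle.toCircle_add]
  rw [h4, ← mul_assoc, h3, one_mul]
  rfl

/-- In an irreducible strongly continuous representation of an abelian group, every circle
subgroup acts through one of its characters. -/
theorem exists_fourier_smul_of_irreducible [CommGroup G] [TopologicalSpace G] [CompleteSpace E]
    (ρ : G →* (E ≃L[ℂ] E)) (hρ : IsStronglyContinuous ρ) (hirr : IsTopologicallyIrreducible ρ)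
    (γ : UnitAddCircle → G) (hγ : Continuous γ) (hadd : ∀ a b, γ (a + b) = γ a * γ b) :
    ∃ n : ℤ, ∀ t x, ρ (γ t) x = fourier n t • x := by
  by_contra! hne
  have hbot : ∀ n, circleEigenspace ρ γ n = ⊥ := by
    intro n
    refine (hirr.2 _ (isClosed_circleEigenspace ρ γ n) ?_).resolve_right ?_
    · intro g x hx t
      have : ρ (γ t) (ρ g x) = ρ g (ρ (γ t) x) := by
        change (ρ (γ t) * ρ g) x = (ρ g * ρ (γ t)) x
        rw [← map_mul, ← map_mul, mul_comm]
      rw [this, hx t, map_smul]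
    · intro htop
      obtain ⟨t, x, h⟩ := hne n
      have hx : x ∈ circleEigenspace ρ γ n := htop ▸ Submodule.mem_top
      exact h (hx t)
  obtain ⟨x, hx⟩ := @exists_ne E hirr.1 0
  refine hx (SeparatingDual.eq_zero_of_forall_dual_eq_zero (R := ℂ) fun ℓ => ?_)
  have hcont : Continuous fun t : UnitAddCircle => ρ (γ t) x := (hρ x).comp hγ
  let f : C(UnitAddCircle, ℂ) := ⟨fun t => ℓ (ρ (γ t) x), ℓ.continuous.comp hcont⟩
  have hcoef : fourierCoeff f = 0 := by
    funext n
    have h0 := fourierCoeff_orbit_mem_circleEigenspace ρ hρ γ hγ hadd x n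
    rw [hbot n, Submodule.mem_bot] at h0
    have hint : Integrable (fun t : UnitAddCircle => fourier (-n) t • ρ (γ t) x)
        AddCircle.haarAddCircle :=
      ((map_continuous (fourier (-n))).smul hcont).integrable_of_hasCompactSupport
        (HasCompactSupport.of_compactSpace _)
    have h1 := ℓ.integral_comp_comm hint
    unfold fourierCoeff at h0 ⊢
    rw [h0, map_zero] at h1
    rw [Pi.zero_apply, ← h1]
    refine integral_congr_ae (.of_forall fun t => ?_)
    simp [f]
  -- A zero Fourier series is summable, so it converges to `f` pointwise; evaluation at `0` gives `ℓ
  -- x = 0`.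
  have hsum := has_pointwise_sum_fourier_series_of_summable (f := f)
    (by rw [hcoef]; exact summable_zero) 0
  rw [hcoef] at hsum
  have hf0 : f 0 = 0 := hsum.unique (by simp)
  have hγ0 : γ 0 = 1 := by
    have := hadd 0 0
    rw [add_zero] at this
    exact left_eq_mul.mp this
  have h1 : ρ (γ 0) x = x := by rw [hγ0, map_one]; rfl
  change ℓ (ρ (γ 0) x) = 0 at hf0
  rwa [h1] at hf0

/-- Elements acting by unimodular scalars. -/
def unimodularScalarSubgroup [Group G] (ρ : G →* (E ≃L[ℂ] E)) : Subgroup G where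
  carrier := {g | ∃ c : Circle, ∀ x, ρ g x = (c : ℂ) • x}
  one_mem' := ⟨1, fun x => by rw [map_one, Circle.coe_one, one_smul]; rfl⟩
  mul_mem' := by
    rintro g h ⟨c, hc⟩ ⟨d, hd⟩
    refine ⟨c * d, fun x => ?_⟩
    rw [map_mul]
    change ρ g (ρ h x) = _
    rw [hd, map_smul, hc, smul_smul, Circle.coe_mul, mul_comm]
  inv_mem' := by
    rintro g ⟨c, hc⟩
    refine ⟨c⁻¹, fun x => ?_⟩
    apply (ρ g).injective
    have : ρ g (ρ g⁻¹ x) = x := by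
      change (ρ g * ρ g⁻¹) x = x
      rw [← map_mul, mul_inv_cancel, map_one]
      rfl
    rw [this, map_smul, hc, smul_smul, ← Circle.coe_mul, inv_mul_cancel, Circle.coe_one,
      one_smul]

/-- A functional with `ℓ x₀ = 1` reads off the scalar as `ℓ (ρ g x₀)`, which is continuous in `g`;
acting by a unimodular scalar thus becomes a family of closed conditions. -/
theorem isClosed_unimodularScalarSubgroup [Group G] [TopologicalSpace G] [Nontrivial E]
    (ρ : G →* (E ≃L[ℂ] E))
    (hρ : IsStronglyContinuous ρ) : IsClosed (unimodularScalarSubgroup ρ : Set G) := by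
  obtain ⟨x₀, hx₀⟩ := exists_ne (0 : E)
  obtain ⟨ℓ, hℓ⟩ := SeparatingDual.exists_eq_one (R := ℂ) hx₀
  have : (unimodularScalarSubgroup ρ : Set G) =
      {g | ‖ℓ (ρ g x₀)‖ = 1} ∩ ⋂ x, {g | ρ g x = ℓ (ρ g x₀) • x} := by
    ext g
    simp only [Set.mem_inter_iff, Set.mem_iInter, Set.mem_ofPred_eq]
    constructor
    · rintro ⟨c, hc⟩
      have hn := Circle.norm_coe c
      simp [hc, hℓ, hn]
    · rintro ⟨h1, h2⟩
      exact ⟨⟨ℓ (ρ g x₀), mem_sphere_zero_iff_norm.2 h1⟩, h2⟩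
  rw [this]
  have hc : Continuous fun g => ℓ (ρ g x₀) := ℓ.continuous.comp (hρ x₀)
  exact (isClosed_eq hc.norm continuous_const).inter
    (isClosed_iInter fun x => isClosed_eq (hρ x) (hc.smul continuous_const))

/-- A minimally almost periodic group in which the circle subgroups generate a dense subgroup
has no nontrivial irreducible Banach representations. -/
theorem hasNoNontrivialIrreducibleBanachRep_of_circles {G : Type u} [CommGroup G]
    [TopologicalSpace G] (hmap : IsMinimallyAlmostPeriodic G)
    (hgen : ∀ S : Subgroup G, IsClosed (S : Set G) →
      (∀ γ : UnitAddCircle → G, Continuous γ → (∀ a b, γ (a + b) = γ a * γ b) → ∀ t, γ t ∈ S) →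
      S = ⊤) :
    HasNoNontrivialIrreducibleBanachRep.{v} G := by
  intro E _ _ _ ρ hρ hirr
  have := hirr.1
  have htop : unimodularScalarSubgroup ρ = ⊤ := by
    refine hgen _ (isClosed_unimodularScalarSubgroup ρ hρ) fun γ hγ hadd t => ?_
    obtain ⟨n, hn⟩ := exists_fourier_smul_of_irreducible ρ hρ hirr γ hγ hadd
    exact ⟨AddCircle.toCircle (n • t), fun x => by rw [hn, fourier_apply]⟩
  have hmem : ∀ g, ∃ c : Circle, ∀ x, ρ g x = (c : ℂ) • x := fun g =>
    (htop ▸ Subgroup.mem_top g : g ∈ unimodularScalarSubgroup ρ)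
  choose c hc using hmem
  obtain ⟨x₀, hx₀⟩ := exists_ne (0 : E)
  obtain ⟨ℓ, hℓ⟩ := SeparatingDual.exists_eq_one (R := ℂ) hx₀
  have hcℓ : ∀ g, (c g : ℂ) = ℓ (ρ g x₀) := fun g => by simp [hc, hℓ]
  let χ : G →* Circle :=
    { toFun := c
      map_one' := by
        apply Circle.ext
        rw [hcℓ, map_one]
        exact hℓ.trans Circle.coe_one.symm
      map_mul' := fun g h => by
        apply Circle.ext
        rw [hcℓ, map_mul]
        change ℓ (ρ g (ρ h x₀)) = _
        rw [hc, hc]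
        simp [hℓ] }
  have hχ : Continuous χ := by
    refine Continuous.subtype_mk (f := fun g => ((c g : Circle) : ℂ)) ?_ (fun g => (c g).2)
    simp_rw [hcℓ]
    exact ℓ.continuous.comp (hρ x₀)
  have h1 := hmap χ hχ
  refine MonoidHom.ext fun g => ContinuousLinearEquiv.ext (funext fun x => ?_)
  have h2 : c g = 1 := DFunLike.congr_fun h1 g
  rw [hc, h2, Circle.coe_one, one_smul]
  rfl

/-- Only continuity of `f` is used, so the image of a faithful representation is covered even when
the representation is not a topological embedding. -/
theorem HasNoNontrivialIrreducibleBanachRep.of_surjective {G : Type u} [Group G]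
    [TopologicalSpace G] {G' : Type w} [Group G'] [TopologicalSpace G']
    (h : HasNoNontrivialIrreducibleBanachRep.{v} G) (f : G →* G') (hf : Continuous f)
    (hsurj : Function.Surjective f) : HasNoNontrivialIrreducibleBanachRep.{v} G' := by
  intro E _ _ _ ρ hρ hirr
  have h1 := h E (ρ.comp f) (fun x => (hρ x).comp hf)
    ⟨hirr.1, fun F hF hinv => hirr.2 F hF fun g => by
      obtain ⟨g, rfl⟩ := hsurj g
      exact hinv g⟩
  refine MonoidHom.ext fun g => ?_
  obtain ⟨g, rfl⟩ := hsurj g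
  exact DFunLike.congr_fun h1 g

theorem IsMonothetic.of_surjective {G G' : Type*} [Group G] [TopologicalSpace G] [Group G']
    [TopologicalSpace G'] (h : IsMonothetic G) (f : G →* G') (hf : Continuous f)
    (hsurj : Function.Surjective f) : IsMonothetic G' := by
  obtain ⟨g, hg⟩ := h
  refine ⟨f g, ?_⟩
  have h1 := hsurj.denseRange.dense_image hf hg
  rwa [← Subgroup.coe_map, MonoidHom.map_zpowers] at h1

end BanachRepresentations

/-! ### Topological generators and small subgroups of the circle -/

section Monothetic

/-- A Baire category criterion for the existence of a topological generator. -/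
theorem isMonothetic_of_dense_torsion {G : Type*} [CommGroup G] [TopologicalSpace G]
    [ContinuousMul G] [BaireSpace G] [SecondCountableTopology G]
    (htor : Dense {g : G | ∃ k : ℕ, 0 < k ∧ g ^ k = 1})
    (hdiv : ∀ (v : G) (W : Set G), IsOpen W → (1 : G) ∈ W → ∀ k : ℕ, 0 < k →
      ∃ n : ℕ, k ∣ n ∧ ∃ w ∈ W, w ^ n = v) :
    IsMonothetic G := by
  let B := TopologicalSpace.countableBasis G
  have hB := TopologicalSpace.isBasis_countableBasis G
  have : Countable B := (TopologicalSpace.countable_countableBasis G).to_subtype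
  have hd : Dense (⋂ V : B, ⋃ n : ℕ, (fun g : G => g ^ n) ⁻¹' (V : Set G)) := by
    refine dense_iInter_of_isOpen (fun V => isOpen_iUnion fun n =>
      (hB.isOpen V.2).preimage (continuous_pow n)) fun V => ?_
    rw [dense_iff_inter_open]
    intro U hU hne
    -- A torsion element `u ∈ U` of exponent `k` is perturbed by a small root `w` of a point `v` of
    -- the target set: if `k ∣ n` and `w ^ n = v`, then `(u * w) ^ n = v`.
    obtain ⟨u, huU, k, hk, huk⟩ := htor.inter_open_nonempty U hU hne
    obtain ⟨v, hv⟩ := TopologicalSpace.nonempty_of_mem_countableBasis V.2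
    obtain ⟨n, ⟨m, rfl⟩, w, hw, hwv⟩ := hdiv v ((fun w => u * w) ⁻¹' U)
      (hU.preimage (continuous_const.mul continuous_id)) (by simpa using huU) k hk
    refine ⟨u * w, hw, Set.mem_iUnion.2 ⟨k * m, ?_⟩⟩
    change (u * w) ^ (k * m) ∈ (V : Set G)
    rw [mul_pow, hwv, pow_mul, huk, one_pow, one_mul]
    exact hv
  obtain ⟨g, hg⟩ := hd.nonempty
  refine ⟨g, hB.dense_iff.2 fun o ho _ => ?_⟩
  obtain ⟨n, hn⟩ := Set.mem_iUnion.1 (Set.mem_iInter.1 hg ⟨o, ho⟩)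
  exact ⟨g ^ n, hn, Subgroup.npow_mem_zpowers g n⟩

/-- The circle group has no small subgroups. -/
theorem Circle.eq_one_of_forall_pow_near (z : Circle)
    (h : ∀ n : ℕ, ‖((z ^ n : Circle) : ℂ) - 1‖ ≤ 1) : z = 1 := by
  have hre : ∀ w : Circle, ‖(w : ℂ) - 1‖ ^ 2 = 2 * (1 - (w : ℂ).re) := by
    intro w
    have hw := Circle.normSq_coe w
    rw [Complex.normSq_apply] at hw
    rw [Complex.sq_norm, Complex.normSq_apply]
    simp only [Complex.sub_re, Complex.one_re, Complex.sub_im, Complex.one_im]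
    linarith
  have hsq : ∀ w : Circle, ((w ^ 2 : Circle) : ℂ).re = 2 * (w : ℂ).re ^ 2 - 1 := by
    intro w
    have hw := Circle.normSq_coe w
    rw [Complex.normSq_apply] at hw
    rw [Circle.coe_pow, pow_two, Complex.mul_re]
    linarith
  have hhalf : ∀ n : ℕ, (1 : ℝ) / 2 ≤ ((z ^ n : Circle) : ℂ).re := by
    intro n
    have h1 := hre (z ^ n)
    have h2 := pow_le_one₀ (n := 2) (norm_nonneg _) (h n)
    linarith
  -- With `c = re w`, squaring changes `1 - c` into `2 (1 - c) (1 + c)`, which is at least `3 (1 -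
  -- c)` once `c ≥ 1 / 2`. Such growth is incompatible with boundedness unless `c = 1`.
  have hgrow : ∀ j : ℕ, (3 : ℝ) ^ j * (1 - (z : ℂ).re) ≤ 1 - ((z ^ 2 ^ j : Circle) : ℂ).re := by
    intro j
    induction j with
    | zero => simp
    | succ j ih =>
      have h1 := hsq (z ^ 2 ^ j)
      rw [← pow_mul, ← pow_succ] at h1
      rw [h1, pow_succ]
      have h2 := hhalf (2 ^ j)
      have h3 := hre (z ^ 2 ^ j)
      nlinarith [sq_nonneg ‖((z ^ 2 ^ j : Circle) : ℂ) - 1‖]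
  have h0 : 1 - (z : ℂ).re = 0 := by
    have hnn : 0 ≤ 1 - (z : ℂ).re := by
      have := hre z
      nlinarith [sq_nonneg ‖(z : ℂ) - 1‖]
    by_contra hne
    have hpos : 0 < 1 - (z : ℂ).re := lt_of_le_of_ne hnn (Ne.symm hne)
    obtain ⟨j, hj⟩ := pow_unbounded_of_one_lt (1 / (1 - (z : ℂ).re)) (by norm_num : (1 : ℝ) < 3)
    rw [div_lt_iff₀ hpos] at hj
    have := hgrow j
    have := hhalf (2 ^ j)
    linarith
  apply Circle.ext
  have h1 := hre z
  rw [h0, mul_zero] at h1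
  simpa [sub_eq_zero] using h1

end Monothetic

/-! ### The group `L₁(X, S¹)`: circles, torsion, completeness -/

namespace L1Circle

variable {X : Type*} [MeasurableSpace X] {μ : Measure X}

/-- The class of `x ↦ exp (i θ x)`. -/
noncomputable def expi (θ : X → ℝ) (hθ : AEMeasurable θ μ) : L1Circle μ :=
  AEEqFun.mk (fun x => Circle.exp (θ x))
    (Circle.exp.continuous.comp_aestronglyMeasurable hθ.aestronglyMeasurable)

theorem toComplex_expi (θ : X → ℝ) (hθ : AEMeasurable θ μ) :
    toComplex (expi θ hθ) =ᵐ[μ] fun x => (Circle.exp (θ x) : ℂ) := by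
  filter_upwards [AEEqFun.coeFn_comp (fun z : Circle => (z : ℂ)) continuous_subtype_val
      (expi θ hθ : X →ₘ[μ] Circle),
    AEEqFun.coeFn_mk (fun x => Circle.exp (θ x))
      (Circle.exp.continuous.comp_aestronglyMeasurable hθ.aestronglyMeasurable)] with x h1 h2
  exact h1.trans (congrArg (fun z : Circle => (z : ℂ)) h2)

theorem expi_congr {θ η : X → ℝ} {hθ : AEMeasurable θ μ} {hη : AEMeasurable η μ}
    (h : ∀ᵐ x ∂μ, Circle.exp (θ x) = Circle.exp (η x)) : expi θ hθ = expi η hη :=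
  AEEqFun.mk_eq_mk.2 h

theorem expi_eq_iff {θ η : X → ℝ} {hθ : AEMeasurable θ μ} {hη : AEMeasurable η μ} :
    expi θ hθ = expi η hη ↔ ∀ᵐ x ∂μ, Circle.exp (θ x) = Circle.exp (η x) :=
  AEEqFun.mk_eq_mk

theorem expi_zero : expi (fun _ => 0) aemeasurable_const = (1 : L1Circle μ) :=
  AEEqFun.mk_eq_mk.2 (.of_forall fun _ => Circle.exp_zero)

theorem expi_add {θ η : X → ℝ} (hθ : AEMeasurable θ μ) (hη : AEMeasurable η μ) :
    expi (fun x => θ x + η x) (hθ.add hη) = expi θ hθ * expi η hη := by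
  refine Eq.trans (AEEqFun.mk_eq_mk.2 (.of_forall fun x => Circle.exp_add _ _))
    (AEEqFun.mk_mul_mk _ _ _ _).symm

theorem expi_sum {ι : Type*} (s : Finset ι) {θ : ι → X → ℝ} (hθ : ∀ i, AEMeasurable (θ i) μ) :
    expi (fun x => ∑ i ∈ s, θ i x) (Finset.aemeasurable_fun_sum s fun i _ => hθ i) =
      ∏ i ∈ s, expi (θ i) (hθ i) := by
  classical
  induction s using Finset.induction_on with
  | empty => simpa using expi_zero
  | insert a s ha ih =>
    rw [Finset.prod_insert ha, ← ih, ← expi_add]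
    exact expi_congr (.of_forall fun x => by rw [Finset.sum_insert ha])

theorem expi_nsmul {θ : X → ℝ} (hθ : AEMeasurable θ μ) (n : ℕ) :
    expi (fun x => n * θ x) (hθ.const_mul _) = expi θ hθ ^ n := by
  have := expi_sum (μ := μ) (Finset.range n) (θ := fun _ => θ) (fun _ => hθ)
  rw [Finset.prod_const, Finset.card_range] at this
  rw [← this]
  exact expi_congr (.of_forall fun x => by simp)

theorem exists_expi (f : L1Circle μ) :
    ∃ (θ : X → ℝ) (hθ : Measurable θ), (∀ x, |θ x| ≤ Real.pi) ∧
      f = expi θ hθ.aemeasurable := by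
  let g : X →ₘ[μ] Circle := f
  have hm : Measurable fun x => ((g x : Circle) : ℂ) :=
    (continuous_subtype_val.comp_stronglyMeasurable (AEEqFun.stronglyMeasurable g)).measurable
  refine ⟨fun x => Complex.arg (g x), Complex.measurable_arg.comp hm,
    fun x => Complex.abs_arg_le_pi _, ?_⟩
  refine (AEEqFun.mk_coeFn g).symm.trans (AEEqFun.mk_eq_mk.2 ?_)
  exact .of_forall fun x => (Circle.exp_arg _).symm

/-- The circle subgroup of functions that are constant on `A` and equal to one elsewhere. -/
noncomputable def step (A : Set X) (hA : MeasurableSet A) (t : ℝ) : L1Circle μ :=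
  expi (A.indicator fun _ => t) (measurable_const.indicator hA).aemeasurable

theorem step_add (A : Set X) (hA : MeasurableSet A) (s t : ℝ) :
    (step A hA (s + t) : L1Circle μ) = step A hA s * step A hA t := by
  rw [step, step, step, ← expi_add]
  refine expi_congr (.of_forall fun x => ?_)
  by_cases hx : x ∈ A <;> simp [hx]

theorem step_two_pi_mul_int (A : Set X) (hA : MeasurableSet A) (n : ℤ) :
    (step A hA (2 * Real.pi * n) : L1Circle μ) = 1 := by
  rw [← expi_zero]
  refine expi_congr (.of_forall fun x => ?_)
  by_cases hx : x ∈ A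
  · simp only [hx, Set.indicator_of_mem, Circle.exp_zero]
    rw [mul_comm]
    exact Circle.exp_int_mul_two_pi n
  · simp [hx]

/-- The step functions as a homomorphism from the circle. -/
noncomputable def stepCircle (A : Set X) (hA : MeasurableSet A) :
    UnitAddCircle →+ Additive (L1Circle μ) :=
  QuotientAddGroup.lift _
    (AddMonoidHom.mk' (fun t : ℝ => Additive.ofMul (step A hA (2 * Real.pi * t)))
      fun s t => by rw [mul_add, step_add]; rfl)
    (by
      rw [AddSubgroup.zmultiples_le]
      have := step_two_pi_mul_int (μ := μ) A hA 1
      rw [Int.cast_one] at this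
      exact this)

/-- The function `θ` rounded to integer multiples of `2 π / k`. -/
noncomputable def roundAngle {X : Type*} (θ : X → ℝ) (k : ℕ) (x : X) : ℝ :=
  2 * Real.pi * (⌊k * θ x / (2 * Real.pi)⌋ : ℝ) / k

theorem measurable_roundAngle {θ : X → ℝ} (hθ : Measurable θ) (k : ℕ) :
    Measurable (roundAngle θ k) := by
  unfold roundAngle
  fun_prop

theorem abs_roundAngle_sub_le {X : Type*} (θ : X → ℝ) {k : ℕ} (hk : 0 < k) (x : X) :
    |roundAngle θ k x - θ x| ≤ 2 * Real.pi / k := by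
  have hk' : (0 : ℝ) < k := by exact_mod_cast hk
  have hpi := Real.pi_pos
  have h1 : roundAngle θ k x - θ x =
      -(Int.fract (k * θ x / (2 * Real.pi)) * (2 * Real.pi / k)) := by
    rw [Int.fract, roundAngle]
    field_simp
    ring
  rw [h1, abs_neg, abs_mul, abs_of_nonneg (Int.fract_nonneg _), abs_of_pos (by positivity)]
  exact mul_le_of_le_one_left (by positivity) (Int.fract_lt_one _).le

theorem expi_roundAngle_pow {θ : X → ℝ} (hθ : Measurable θ) {k : ℕ} (hk : 0 < k) :
    (expi (roundAngle θ k) (measurable_roundAngle hθ k).aemeasurable : L1Circle μ) ^ k = 1 := by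
  rw [← expi_nsmul, ← expi_zero]
  refine expi_congr (.of_forall fun x => ?_)
  have hk' : (k : ℝ) ≠ 0 := by exact_mod_cast hk.ne'
  have : (k : ℝ) * roundAngle θ k x = ⌊k * θ x / (2 * Real.pi)⌋ * (2 * Real.pi) := by
    rw [roundAngle]
    field_simp
  rw [this, Circle.exp_zero, Circle.exp_int_mul_two_pi]

/-- Since `|θ| ≤ π`, the rounded angle takes finitely many values, indexed by `-k, …, k`; its
exponential is a finite product of step functions. -/
theorem expi_roundAngle_mem {θ : X → ℝ} (hθ : Measurable θ) (hb : ∀ x, |θ x| ≤ Real.pi)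
    {k : ℕ} (hk : 0 < k) (S : Subgroup (L1Circle μ))
    (hS : ∀ (A : Set X) (hA : MeasurableSet A) (t : ℝ), step A hA t ∈ S) :
    expi (roundAngle θ k) (measurable_roundAngle hθ k).aemeasurable ∈ S := by
  have hm : Measurable fun x => ⌊k * θ x / (2 * Real.pi)⌋ := by fun_prop
  have hA : ∀ j : ℤ, MeasurableSet {x | ⌊k * θ x / (2 * Real.pi)⌋ = j} := fun j =>
    hm (measurableSet_singleton j)
  have h1 := expi_sum (μ := μ) (Finset.Icc (-k : ℤ) k)
    (θ := fun j : ℤ => {x | ⌊k * θ x / (2 * Real.pi)⌋ = j}.indicator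
      fun _ => 2 * Real.pi * (j : ℝ) / k)
    (fun j => (measurable_const.indicator (hA j)).aemeasurable)
  have h2 : expi (roundAngle θ k) (measurable_roundAngle hθ k).aemeasurable =
      ∏ j ∈ Finset.Icc (-k : ℤ) k, (step _ (hA j) (2 * Real.pi * (j : ℝ) / k) : L1Circle μ) := by
    refine Eq.trans (expi_congr (.of_forall fun x => ?_)) h1
    congr 1
    have hk' : (0 : ℝ) < k := by exact_mod_cast hk
    have hpi := Real.pi_pos
    obtain ⟨hb1, hb2⟩ := abs_le.1 (hb x)
    rw [Finset.sum_eq_single ⌊k * θ x / (2 * Real.pi)⌋]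
    · simp [roundAngle]
    · intro j _ hj
      exact Set.indicator_of_notMem (fun h => hj h.symm) _
    · intro h
      refine absurd (Finset.mem_Icc.2 ⟨Int.le_floor.2 ?_, ?_⟩) h
      · rw [le_div_iff₀ (by positivity)]
        push_cast
        nlinarith
      · have : (⌊k * θ x / (2 * Real.pi)⌋ : ℝ) ≤ k := by
          refine (Int.floor_le _).trans ?_
          rw [div_le_iff₀ (by positivity)]
          nlinarith
        exact_mod_cast this
  rw [h2]
  exact S.prod_mem fun j _ => hS _ _ _

section Finite

variable [IsFiniteMeasure μ]

theorem dist_expi {θ η : X → ℝ} (hθ : AEMeasurable θ μ) (hη : AEMeasurable η μ) :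
    dist (expi θ hθ) (expi η hη) =
      ∫ x, ‖(Circle.exp (θ x) : ℂ) - Circle.exp (η x)‖ ∂μ := by
  rw [dist_eq]
  apply integral_congr_ae
  filter_upwards [toComplex_expi θ hθ, toComplex_expi η hη] with x h1 h2
  rw [h1, h2]

theorem integrable_norm_sub (f g : L1Circle μ) :
    Integrable (fun x => ‖toComplex f x - toComplex g x‖) μ := by
  refine (Integrable.sub ?_ ?_).norm
  · exact (memLp_one_iff_integrable.1 (Lp.memLp (toLp f)))
  · exact (memLp_one_iff_integrable.1 (Lp.memLp (toLp g)))

theorem dist_mul_mul_le (f g f' g' : L1Circle μ) :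
    dist (f * f') (g * g') ≤ dist f g + dist f' g' := by
  simp only [dist_eq]
  rw [← integral_add (integrable_norm_sub f g) (integrable_norm_sub f' g')]
  refine integral_mono_ae (integrable_norm_sub _ _)
    ((integrable_norm_sub f g).add (integrable_norm_sub f' g')) ?_
  filter_upwards [norm_toComplex g, norm_toComplex f',
    AEEqFun.coeFn_mul (toComplex f) (toComplex f'),
    AEEqFun.coeFn_mul (toComplex g) (toComplex g')] with x h1 h2 h3 h4
  simp only [toComplex_mul, h3, h4, Pi.mul_apply]
  have h5 : toComplex f x * toComplex f' x - toComplex g x * toComplex g' x =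
      (toComplex f x - toComplex g x) * toComplex f' x +
        toComplex g x * (toComplex f' x - toComplex g' x) := by ring
  rw [h5]
  refine (norm_add_le _ _).trans ?_
  rw [norm_mul, norm_mul, h1, h2, mul_one, one_mul]

instance : ContinuousMul (L1Circle μ) where
  continuous_mul := by
    rw [continuous_iff_continuousAt]
    rintro ⟨f, g⟩
    refine tendsto_iff_dist_tendsto_zero.2 (squeeze_zero (fun _ => dist_nonneg)
      (fun q => dist_mul_mul_le q.1 f q.2 g) ?_)
    have h1 : Filter.Tendsto (fun q : L1Circle μ × L1Circle μ => dist q.1 f + dist q.2 g)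
        (nhds (f, g)) (nhds (dist f f + dist g g)) := by
      apply Continuous.tendsto' (by fun_prop)
      rfl
    simpa using h1

/-- Functions that differ only on a small set are close. -/
theorem dist_expi_le_of_eqOn_compl {θ η : X → ℝ} (hθ : AEMeasurable θ μ) (hη : AEMeasurable η μ)
    {A : Set X} (hA : MeasurableSet A) (h : ∀ x ∉ A, θ x = η x) :
    dist (expi θ hθ) (expi η hη) ≤ 2 * μ.real A := by
  rw [dist_expi]
  have h1 : ∫ x, A.indicator (fun _ => (2 : ℝ)) x ∂μ = 2 * μ.real A := by
    rw [integral_indicator_const _ hA, smul_eq_mul, mul_comm]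
  rw [← h1]
  refine integral_mono_of_nonneg (.of_forall fun _ => norm_nonneg _)
    ((integrable_const _).indicator hA) (.of_forall fun x => ?_)
  by_cases hx : x ∈ A
  · simp only [Set.indicator_of_mem hx]
    refine (norm_sub_le _ _).trans ?_
    rw [Circle.norm_coe, Circle.norm_coe]
    norm_num
  · simp [hx, h x hx]

theorem _root_.Circle.norm_exp_sub_exp_le (s t : ℝ) :
    ‖(Circle.exp s : ℂ) - Circle.exp t‖ ≤ |s - t| := by
  have h1 : (Circle.exp s : ℂ) = Circle.exp t * Circle.exp (s - t) := by
    rw [← Circle.coe_mul, ← Circle.exp_add]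
    congr 2
    ring
  have h2 : (Circle.exp s : ℂ) - Circle.exp t = Circle.exp t * (Circle.exp (s - t) - 1) := by
    rw [h1]
    ring
  rw [h2, norm_mul, Circle.norm_coe, one_mul, Circle.coe_exp, mul_comm]
  exact Real.norm_exp_I_mul_ofReal_sub_one_le

theorem dist_expi_le_of_abs_sub_le {θ η : X → ℝ} (hθ : AEMeasurable θ μ) (hη : AEMeasurable η μ)
    {ε : ℝ} (h : ∀ x, |θ x - η x| ≤ ε) :
    dist (expi θ hθ) (expi η hη) ≤ ε * μ.real Set.univ := by
  rw [dist_expi]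
  have h1 : ∫ _, ε ∂μ = ε * μ.real Set.univ := by
    rw [integral_const, smul_eq_mul, mul_comm]
  rw [← h1]
  exact integral_mono_of_nonneg (.of_forall fun _ => norm_nonneg _) (integrable_const _)
    (.of_forall fun x => (Circle.norm_exp_sub_exp_le _ _).trans (h x))

theorem isometry_toLp : Isometry (toLp : L1Circle μ → Lp ℂ 1 μ) := fun _ _ => rfl

/-- Needed for the Baire property. An `L₁` limit of unimodular functions is an almost everywhere
limit along a subsequence, hence unimodular. -/
instance : CompleteSpace (L1Circle μ) := by
  rw [completeSpace_iff_isComplete_range isometry_toLp.isUniformInducing]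
  refine IsClosed.isComplete (isSeqClosed_iff_isClosed.1 ?_)
  intro F G hF hlim
  obtain ⟨ns, hns, hae⟩ := (tendstoInMeasure_of_tendsto_Lp hlim).exists_seq_tendsto_ae
  have hnorm : ∀ᵐ x ∂μ, ‖G x‖ = 1 := by
    have h1 : ∀ᵐ x ∂μ, ∀ n, ‖F n x‖ = 1 := by
      rw [ae_all_iff]
      intro n
      obtain ⟨f, hf⟩ := hF n
      rw [← hf]
      exact norm_toComplex f
    filter_upwards [hae, h1] with x h2 h3
    refine tendsto_nhds_unique h2.norm ?_
    simp [h3]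
  have hm : AEMeasurable (fun x => Complex.arg (G x)) μ :=
    Complex.measurable_arg.comp_aemeasurable (Lp.aestronglyMeasurable G).aemeasurable
  refine ⟨expi _ hm, Lp.ext ?_⟩
  filter_upwards [toComplex_expi _ hm, hnorm] with x h1 h2
  refine h1.trans ?_
  rw [Circle.coe_exp]
  have := Complex.norm_mul_exp_arg_mul_I (G x)
  rwa [h2, Complex.ofReal_one, one_mul] at this

instance [StandardBorelSpace X] : SecondCountableTopology (L1Circle μ) := by
  have : Fact ((1 : ℝ≥0∞) ≠ ∞) := ⟨ENNReal.one_ne_top⟩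
  exact isometry_toLp.isUniformInducing.isInducing.secondCountableTopology

theorem dist_step_le (A : Set X) (hA : MeasurableSet A) (s t : ℝ) :
    dist (step A hA s : L1Circle μ) (step A hA t) ≤ |s - t| * μ.real Set.univ := by
  refine dist_expi_le_of_abs_sub_le _ _ fun x => ?_
  by_cases hx : x ∈ A <;> simp [hx]

theorem continuous_stepCircle (A : Set X) (hA : MeasurableSet A) :
    Continuous fun t => (stepCircle A hA t).toMul (α := L1Circle μ) := by
  refine continuous_quot_lift _ ?_
  change Continuous fun t : ℝ => (step A hA (2 * Real.pi * t) : L1Circle μ)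
  rw [continuous_iff_continuousAt]
  intro t
  refine tendsto_iff_dist_tendsto_zero.2 (squeeze_zero (fun _ => dist_nonneg)
      (fun s => dist_step_le A hA _ _) ?_)
  apply Continuous.tendsto' (by fun_prop)
  simp

theorem step_mem_of_circles (S : Subgroup (L1Circle μ))
    (hS : ∀ γ : UnitAddCircle → L1Circle μ, Continuous γ →
      (∀ a b, γ (a + b) = γ a * γ b) → ∀ t, γ t ∈ S)
    (A : Set X) (hA : MeasurableSet A) (t : ℝ) : step A hA t ∈ S := by
  have h1 := hS (fun t => (stepCircle A hA t).toMul) (continuous_stepCircle A hA)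
    (fun a b => by rw [map_add]; rfl) ((t / (2 * Real.pi) : ℝ) : UnitAddCircle)
  have h2 : (step A hA (2 * Real.pi * (t / (2 * Real.pi))) : L1Circle μ) ∈ S := h1
  rwa [mul_div_cancel₀ _ (by positivity)] at h2

theorem tendsto_expi_roundAngle {θ : X → ℝ} (hθ : Measurable θ) :
    Filter.Tendsto
      (fun k => (expi (roundAngle θ k) (measurable_roundAngle hθ k).aemeasurable : L1Circle μ))
      Filter.atTop (nhds (expi θ hθ.aemeasurable)) := by
  refine tendsto_iff_dist_tendsto_zero.2 (squeeze_zero' (.of_forall fun _ => dist_nonneg)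
    ((Filter.eventually_gt_atTop 0).mono fun k hk =>
      dist_expi_le_of_abs_sub_le _ _ (abs_roundAngle_sub_le θ hk)) ?_)
  have := (tendsto_const_div_atTop_nhds_zero_nat (2 * Real.pi)).mul_const (μ.real Set.univ)
  rwa [zero_mul] at this

theorem dense_torsion : Dense {f : L1Circle μ | ∃ k : ℕ, 0 < k ∧ f ^ k = 1} := by
  intro f
  obtain ⟨θ, hθ, -, rfl⟩ := exists_expi f
  exact mem_closure_of_tendsto (tendsto_expi_roundAngle hθ)
    ((Filter.eventually_gt_atTop 0).mono fun k hk => ⟨k, hk, expi_roundAngle_pow hθ hk⟩)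

theorem eq_top_of_circles_mem (S : Subgroup (L1Circle μ)) (hcl : IsClosed (S : Set (L1Circle μ)))
    (hS : ∀ γ : UnitAddCircle → L1Circle μ, Continuous γ →
      (∀ a b, γ (a + b) = γ a * γ b) → ∀ t, γ t ∈ S) : S = ⊤ := by
  rw [eq_top_iff]
  intro f _
  obtain ⟨θ, hθ, hb, rfl⟩ := exists_expi f
  exact hcl.mem_of_tendsto (tendsto_expi_roundAngle hθ)
    ((Filter.eventually_gt_atTop 0).mono fun k hk =>
      expi_roundAngle_mem hθ hb hk S (step_mem_of_circles S hS))

/-- Roots close to the identity are obtained by dividing a bounded argument function by `n`. -/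
theorem isMonothetic [StandardBorelSpace X] : IsMonothetic (L1Circle μ) := by
  refine isMonothetic_of_dense_torsion dense_torsion fun v W hW h1 k hk => ?_
  obtain ⟨θ, hθ, hb, rfl⟩ := exists_expi v
  have hlim : Filter.Tendsto (fun n : ℕ => (expi (fun x => (1 / n : ℝ) * θ x)
      (hθ.const_mul _).aemeasurable : L1Circle μ)) Filter.atTop (nhds 1) := by
    rw [← expi_zero]
    refine tendsto_iff_dist_tendsto_zero.2 (squeeze_zero (fun _ => dist_nonneg)
      (fun n => dist_expi_le_of_abs_sub_le (ε := Real.pi / n) _ _ fun x => ?_) ?_)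
    · rw [sub_zero, abs_mul, abs_of_nonneg (by positivity), one_div, inv_mul_eq_div]
      gcongr
      exact hb x
    · have := (tendsto_const_div_atTop_nhds_zero_nat Real.pi).mul_const (μ.real Set.univ)
      rwa [zero_mul] at this
  obtain ⟨N, hN⟩ := Filter.eventually_atTop.1 (hlim.eventually_mem (hW.mem_nhds h1))
  refine ⟨k * (N + 1), dvd_mul_right _ _, _, hN (k * (N + 1)) (by nlinarith), ?_⟩
  rw [← expi_nsmul]
  refine expi_congr (.of_forall fun x => ?_)
  have : ((k * (N + 1) : ℕ) : ℝ) ≠ 0 := by positivity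
  congr 1
  field_simp

end Finite

end L1Circle

/-! ### Nonatomic measures and the dimension of `L₂` -/

section Nonatomic

variable {X : Type*} [MeasurableSpace X]

/-- A finite nonatomic measure space is covered, up to a set of small measure, by finitely many
sets of small measure. -/
theorem exists_cover_measure_le [StandardBorelSpace X] (μ : Measure X) [IsFiniteMeasure μ]
    [NullSingletonClass μ] {ε : ℝ≥0∞} (hε : 0 < ε) :
    ∃ (N : ℕ) (A : ℕ → Set X), (∀ i, MeasurableSet (A i)) ∧ (∀ i, μ (A i) ≤ ε) ∧
      μ (⋃ i ∈ Finset.range N, A i)ᶜ ≤ ε := by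
  let := upgradeStandardBorel X
  have hU : ∀ x : X, ∃ U : Set X, x ∈ U ∧ IsOpen U ∧ μ U < ε := by
    intro x
    obtain ⟨U, h1, h2, h3⟩ := Set.exists_isOpen_lt_of_lt (μ := μ) {x} ε (by simpa using hε)
    exact ⟨U, h1 rfl, h2, h3⟩
  choose U hxU hUo hUμ using hU
  obtain ⟨s, hs, hcov⟩ := TopologicalSpace.countable_cover_nhds
    (fun x => (hUo x).mem_nhds (hxU x))
  obtain ⟨A, hA, hAcov⟩ : ∃ A : ℕ → Set X, (∀ i, MeasurableSet (A i) ∧ μ (A i) ≤ ε) ∧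
      ⋃ i, A i = Set.univ := by
    rcases s.eq_empty_or_nonempty with rfl | hne
    · refine ⟨fun _ => ∅, fun i => by simp, ?_⟩
      simpa using hcov
    · obtain ⟨e, rfl⟩ := hs.exists_eq_range hne
      exact ⟨fun i => U (e i), fun i => ⟨(hUo _).measurableSet, (hUμ _).le⟩, by simpa using hcov⟩
  have hlim := tendsto_measure_iInter_atTop (μ := μ) (s := fun N => (⋃ i ∈ Finset.range N, A i)ᶜ)
    (fun N => (Finset.measurableSet_biUnion _ fun i _ => (hA i).1).compl.nullMeasurableSet)
    (fun M N h => Set.compl_subset_compl.2 (Set.biUnion_subset_biUnion_left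
      (by simpa using Finset.range_subset_range.2 h))) ⟨0, measure_ne_top _ _⟩
  have h0 : ⋂ N, (⋃ i ∈ Finset.range N, A i)ᶜ = ∅ := by
    rw [← Set.compl_iUnion, Set.compl_empty_iff, Set.eq_univ_iff_forall]
    intro x
    obtain ⟨i, hi⟩ := Set.mem_iUnion.1 (hAcov ▸ Set.mem_univ x)
    exact Set.mem_iUnion.2 ⟨i + 1, Set.mem_biUnion (by simp) hi⟩
  rw [h0, measure_empty] at hlim
  obtain ⟨N, hN⟩ := (hlim.eventually (ge_mem_nhds hε)).exists
  exact ⟨N, A, fun i => (hA i).1, fun i => (hA i).2, hN⟩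

/-- Otherwise every subset of `A` is null or has full measure in `A`. Pieces of measure at most `μ A
/ 2` then meet `A` in null sets, yet finitely many of them and a small remainder cover `A`. -/
theorem exists_subset_measure_lt [StandardBorelSpace X] (μ : Measure X) [IsFiniteMeasure μ]
    [NullSingletonClass μ] {A : Set X} (hA : MeasurableSet A) (hpos : 0 < μ A) :
    ∃ B ⊆ A, MeasurableSet B ∧ 0 < μ B ∧ μ B < μ A := by
  obtain ⟨N, C, hC, hCμ, hcompl⟩ := exists_cover_measure_le μ (ENNReal.half_pos hpos.ne')
  have hlt : μ A / 2 < μ A := ENNReal.half_lt_self hpos.ne' (measure_ne_top _ _)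
  by_contra! hB
  have h1 : ∀ B, MeasurableSet B → μ B ≤ μ A / 2 → μ (A ∩ B) = 0 := by
    intro B hBm hBμ
    by_contra hne
    have := hB (A ∩ B) Set.inter_subset_left (hA.inter hBm) (pos_iff_ne_zero.2 hne)
    exact absurd ((this.trans (measure_mono Set.inter_subset_right)).trans hBμ) hlt.not_ge
  have hU : MeasurableSet (⋃ i ∈ Finset.range N, C i) :=
    Finset.measurableSet_biUnion _ fun i _ => hC i
  have h2 := h1 _ hU.compl hcompl
  have h3 : μ (A ∩ ⋃ i ∈ Finset.range N, C i) = 0 := by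
    rw [Set.inter_iUnion₂]
    exact (measure_biUnion_null_iff (Finset.range N).countable_toSet).2
      fun i _ => h1 _ (hC i) (hCμ i)
  have h4 := measure_inter_add_sdiff (μ := μ) A hU
  rw [Set.sdiff_eq, h2, h3, add_zero] at h4
  exact hpos.ne h4

/-- Repeatedly shrinking the space gives infinitely many disjoint differences of positive measure,
whose indicators are orthogonal and nonzero. -/
theorem not_finiteDimensional_Lp_two [StandardBorelSpace X] (μ : Measure X) [IsFiniteMeasure μ]
    [NeZero μ] [NullSingletonClass μ] : ¬ FiniteDimensional ℂ (Lp ℂ 2 μ) := by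
  intro hfin
  let S := {A : Set X // MeasurableSet A ∧ 0 < μ A}
  have hstep : ∀ A : S, ∃ B : S, B.1 ⊆ A.1 ∧ μ B.1 < μ A.1 := by
    rintro ⟨A, hA, hpos⟩
    obtain ⟨B, h1, h2, h3, h4⟩ := exists_subset_measure_lt μ hA hpos
    exact ⟨⟨B, h2, h3⟩, h1, h4⟩
  choose nxt hnxt using hstep
  let A : ℕ → S := fun n => nxt^[n] ⟨Set.univ, .univ, by simp [NeZero.ne μ]⟩
  have hA : ∀ n, A (n + 1) = nxt (A n) := fun n => Function.iterate_succ_apply' _ _ _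
  have hanti : Antitone fun n => (A n).1 := antitone_nat_of_succ_le fun n => by
    rw [hA]; exact (hnxt _).1
  let D : ℕ → Set X := fun n => (A n).1 \ (A (n + 1)).1
  have hD : ∀ n, MeasurableSet (D n) := fun n => MeasurableSet.diff (A n).2.1 (A (n + 1)).2.1
  have hDpos : ∀ n, μ.real (D n) ≠ 0 := by
    intro n h
    rw [measureReal_eq_zero_iff] at h
    have h1 : (A (n + 1)).1 ⊆ (A n).1 := by rw [hA]; exact (hnxt _).1
    have h2 : μ (A (n + 1)).1 < μ (A n).1 := by rw [hA]; exact (hnxt _).2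
    have h4 : μ (A n).1 ≤ μ (A (n + 1)).1 := by
      have := measure_mono (μ := μ) (Set.subset_union_right (s := (A (n+1)).1) (t := (A n).1))
      rw [← Set.union_sdiff_self] at this
      refine this.trans ((measure_union_le _ _).trans ?_)
      change _ + μ (D n) ≤ _
      rw [h, add_zero]
    exact absurd h4 h2.not_ge
  have hdisj : ∀ i j, i ≠ j → D i ∩ D j = ∅ := by
    have : ∀ i j, i < j → D i ∩ D j = ∅ := by
      intro i j hij
      ext x
      simp only [Set.mem_inter_iff, Set.mem_empty_iff_false, iff_false]
      rintro ⟨⟨_, h1⟩, ⟨h2, _⟩⟩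
      exact h1 (hanti hij h2)
    intro i j hij
    rcases hij.lt_or_gt with h | h
    · exact this i j h
    · rw [Set.inter_comm]; exact this j i h
  let v : ℕ → Lp ℂ 2 μ := fun n => indicatorConstLp 2 (hD n) (measure_ne_top _ _) (1 : ℂ)
  have hin : ∀ i j, inner ℂ (v i) (v j) = (μ.real (D i ∩ D j) : ℂ) := fun i j =>
    L2.inner_indicatorConstLp_one_indicatorConstLp_one (𝕜 := ℂ) (hD i) (hD j)
  have hli : LinearIndependent ℂ v := by
    refine linearIndependent_of_ne_zero_of_inner_eq_zero (𝕜 := ℂ) ?_ ?_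
    · intro i h
      have := hin i i
      rw [h, inner_zero_left, Set.inter_self] at this
      exact hDpos i (by exact_mod_cast this.symm)
    · intro i j hij
      rw [hin, hdisj i j hij]
      simp
  exact not_finite_iff_infinite.2 inferInstance hli.finite

end Nonatomic

/-! ### Characters and the multiplication representation of `L₁(X, S¹)` -/

namespace L1Circle

variable {X : Type*} [MeasurableSpace X] {μ : Measure X}

theorem mulLp_sub_mulLp_ae (f g : L1Circle μ) (φ : Lp ℂ 2 μ) :
    (mulLp f φ - mulLp g φ : Lp ℂ 2 μ) =ᵐ[μ] fun x => (toComplex f x - toComplex g x) * φ x := by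
  filter_upwards [Lp.coeFn_sub (mulLp f φ) (mulLp g φ), mulRep_apply f φ, mulRep_apply g φ]
    with x h1 h2 h3
  rw [h1, Pi.sub_apply, sub_mul]
  exact congrArg₂ (· - ·) h2 h3

theorem norm_toComplex_sub_le (f g : L1Circle μ) :
    ∀ᵐ x ∂μ, ‖toComplex f x - toComplex g x‖ ≤ 2 := by
  filter_upwards [norm_toComplex f, norm_toComplex g] with x h1 h2
  refine (norm_sub_le _ _).trans ?_
  rw [h1, h2]
  norm_num

theorem norm_sq_eq_integral (φ : Lp ℂ 2 μ) : ‖φ‖ ^ 2 = ∫ x, ‖φ x‖ ^ 2 ∂μ := by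
  have h1 : ((‖φ‖ ^ 2 : ℝ) : ℂ) = ((∫ x, ‖φ x‖ ^ 2 ∂μ : ℝ) : ℂ) := by
    rw [← integral_complex_ofReal]
    have h2 := L2.inner_def (𝕜 := ℂ) φ φ
    rw [inner_self_eq_norm_sq_to_K] at h2
    push_cast
    refine Eq.trans (by simp) (h2.trans ?_)
    refine integral_congr_ae (.of_forall fun x => ?_)
    simp [inner_self_eq_norm_sq_to_K]
  exact_mod_cast h1

variable [IsFiniteMeasure μ]

/-- Functions equal to one off a set of small measure form a subgroup near the identity. Its image
under a character is a small subgroup of the circle, hence trivial; finitely many such sets cover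
`X`. -/
theorem isMinimallyAlmostPeriodic [StandardBorelSpace X] [NullSingletonClass μ] :
    IsMinimallyAlmostPeriodic (L1Circle μ) := by
  intro χ hχ
  have hnear : ∀ᶠ f in nhds (1 : L1Circle μ), ‖((χ f : Circle) : ℂ) - 1‖ < 1 := by
    have hc : Continuous fun f => ‖((χ f : Circle) : ℂ) - 1‖ :=
      ((continuous_subtype_val.comp hχ).sub continuous_const).norm
    refine hc.continuousAt.eventually_lt continuousAt_const ?_
    simp
  obtain ⟨δ, hδ, hball⟩ := Metric.eventually_nhds_iff.1 hnear
  let P : Set X → Prop := fun A => ∀ (θ : X → ℝ) (hθ : AEMeasurable θ μ), (∀ x ∉ A, θ x = 0) →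
    χ (expi θ hθ) = 1
  have hsmall : ∀ A, MeasurableSet A → μ A ≤ ENNReal.ofReal (δ / 4) → P A := by
    intro A hA hμ θ hθ h0
    refine Circle.eq_one_of_forall_pow_near _ fun n => ?_
    rw [← map_pow, ← expi_nsmul]
    refine (hball ?_).le
    rw [← expi_zero]
    refine (dist_expi_le_of_eqOn_compl _ _ hA fun x hx => by rw [h0 x hx, mul_zero]).trans_lt ?_
    have h1 : μ.real A ≤ δ / 4 := ENNReal.toReal_le_of_le_ofReal (by positivity) hμ
    linarith
  have hunion : ∀ A B, MeasurableSet A → P A → P B → P (A ∪ B) := by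
    intro A B hA hPA hPB θ hθ h0
    have h1 : expi θ hθ = expi (A.indicator θ) (hθ.indicator hA) *
        expi (Aᶜ.indicator θ) (hθ.indicator hA.compl) := by
      rw [← expi_add]
      exact expi_congr (.of_forall fun x => by
        rw [← Pi.add_apply, Set.indicator_self_add_compl])
    rw [h1, map_mul, hPA _ _ (fun x hx => Set.indicator_of_notMem hx _), hPB, one_mul]
    intro x hx
    by_cases hxA : x ∈ A
    · exact Set.indicator_of_notMem (by simpa using hxA) _
    · rw [Set.indicator_of_mem (by simpa using hxA), h0]
      simp [hx, hxA]
  obtain ⟨N, A, hA, hAμ, hcompl⟩ := exists_cover_measure_le μ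
    (ENNReal.ofReal_pos.2 (by positivity : 0 < δ / 4))
  have hfin : ∀ N, P (⋃ i ∈ Finset.range N, A i) := by
    intro N
    induction N with
    | zero => exact hsmall _ (by simp) (by simp)
    | succ N ih =>
      rw [Finset.range_add_one, Finset.set_biUnion_insert]
      exact hunion _ _ (hA N) (hsmall _ (hA N) (hAμ N)) ih
  have hmeas : MeasurableSet (⋃ i ∈ Finset.range N, A i) :=
    Finset.measurableSet_biUnion _ fun i _ => hA i
  have huniv := hunion _ _ hmeas (hfin N) (hsmall _ hmeas.compl hcompl)
  refine MonoidHom.ext fun f => ?_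
  obtain ⟨θ, hθ, -, rfl⟩ := exists_expi f
  exact huniv θ _ fun x hx => absurd (by rw [Set.union_compl_self]; trivial) hx

theorem hasNoNontrivialIrreducibleBanachRep {X : Type w} [MeasurableSpace X]
    [StandardBorelSpace X] {μ : Measure X} [IsFiniteMeasure μ] [NullSingletonClass μ] :
    HasNoNontrivialIrreducibleBanachRep.{v} (L1Circle μ) :=
  hasNoNontrivialIrreducibleBanachRep_of_circles isMinimallyAlmostPeriodic
    fun S hcl hS => eq_top_of_circles_mem S hcl hS

/-- Since `|f - g| ≤ 2`, the square `|f - g| ^ 2` is at most `2 |f - g|`: the `L₁` metric controls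
the action on bounded functions. -/
theorem norm_mulLp_sub_mulLp_sq_le (f g : L1Circle μ) (φ : Lp ℂ 2 μ) {M : ℝ}
    (hM : ∀ᵐ x ∂μ, ‖φ x‖ ≤ M) :
    ‖mulLp f φ - mulLp g φ‖ ^ 2 ≤ 2 * M ^ 2 * dist f g := by
  rw [norm_sq_eq_integral, dist_eq, ← integral_const_mul]
  refine integral_mono_of_nonneg (.of_forall fun _ => sq_nonneg _)
    ((integrable_norm_sub f g).const_mul _) ?_
  filter_upwards [mulLp_sub_mulLp_ae f g φ, hM, norm_toComplex_sub_le f g] with x h1 h2 h3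
  rw [h1, norm_mul, mul_pow]
  have h4 : ‖φ x‖ ^ 2 ≤ M ^ 2 := pow_le_pow_left₀ (norm_nonneg _) h2 2
  have h5 := norm_nonneg (toComplex f x - toComplex g x)
  have h6 : ‖toComplex f x - toComplex g x‖ ^ 2 ≤ 2 * ‖toComplex f x - toComplex g x‖ := by
    nlinarith
  calc _ ≤ (2 * ‖toComplex f x - toComplex g x‖) * M ^ 2 := by gcongr
    _ = _ := by ring

theorem continuous_mulLp (φ : Lp ℂ 2 μ) : Continuous fun f : L1Circle μ => mulLp f φ := by
  refine Lp.induction (by norm_num) (motive := fun φ => Continuous fun f : L1Circle μ => mulLp f φ)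
    ?_ ?_ ?_ φ
  · intro c s hs hμs
    rw [continuous_iff_continuousAt]
    intro f
    refine tendsto_iff_norm_sub_tendsto_zero.2 ?_
    have hb : ∀ᵐ x ∂μ, ‖(Lp.simpleFunc.indicatorConst 2 hs hμs.ne c : Lp ℂ 2 μ) x‖ ≤ ‖c‖ := by
      rw [Lp.simpleFunc.coe_indicatorConst]
      filter_upwards [indicatorConstLp_coeFn (p := 2) (hs := hs) (hμs := hμs.ne) (c := c)]
        with x hx
      rw [hx]
      exact norm_indicator_le_norm_self (fun _ => c) x
    have h1 : Filter.Tendsto (fun g : L1Circle μ => √(2 * ‖c‖ ^ 2 * dist g f)) (nhds f)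
        (nhds 0) := by
      apply Continuous.tendsto' (by fun_prop)
      simp
    exact squeeze_zero (fun _ => norm_nonneg _)
      (fun g => Real.le_sqrt_of_sq_le (norm_mulLp_sub_mulLp_sq_le g f _ hb)) h1
  · intro φ ψ hφ hψ _ h1 h2
    have : ∀ f : L1Circle μ, mulLp f (hφ.toLp φ + hψ.toLp ψ) =
        mulLp f (hφ.toLp φ) + mulLp f (hψ.toLp ψ) := fun f => (mulUnitary f).map_add _ _
    simp only [this]
    exact h1.add h2
  -- Multiplication operators are isometries, so the orbit maps of `φs n` converge uniformly to that
  -- of `φ`.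
  · refine isSeqClosed_iff_isClosed.1 fun φs φ hφs hlim => ?_
    refine TendstoUniformly.continuous (F := fun n (f : L1Circle μ) => mulLp f (φs n))
      (p := Filter.atTop) ?_ (.of_forall hφs)
    rw [Metric.tendstoUniformly_iff]
    intro ε hε
    filter_upwards [Metric.tendsto_nhds.1 hlim ε hε] with n hn f
    change dist (mulUnitary f φ) (mulUnitary f (φs n)) < ε
    rwa [LinearIsometryEquiv.dist_map, dist_comm]

theorem continuous_mulRep : Continuous (mulRep μ) :=
  continuous_induced_rng.2 (continuous_pi fun φ => continuous_mulLp φ)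

theorem continuous_unitary_apply {H : Type*} [NormedAddCommGroup H] [InnerProductSpace ℂ H]
    (x : H) : Continuous fun U : H ≃ₗᵢ[ℂ] H => U x :=
  (continuous_apply x).comp continuous_induced_dom

/-- Integrate `t ≤ η + t ^ 2 / η` with `t = |f - g|`. The `L₁` distance is thereby controlled by the
action on the constant function one, which yields the embedding. -/
theorem dist_le_of_mulLp_one (f g : L1Circle μ) {η : ℝ} (hη : 0 < η) :
    dist f g ≤ η * μ.real Set.univ +
      ‖mulLp f (indicatorConstLp 2 .univ (measure_ne_top μ _) 1) -
        mulLp g (indicatorConstLp 2 .univ (measure_ne_top μ _) 1)‖ ^ 2 / η := by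
  rw [norm_sq_eq_integral, dist_eq]
  have h1 : η * μ.real Set.univ = ∫ _, η ∂μ := by
    rw [integral_const, smul_eq_mul, mul_comm]
  have hint := (Lp.memLp (mulLp f (indicatorConstLp 2 .univ (measure_ne_top μ _) 1) -
        mulLp g (indicatorConstLp 2 .univ (measure_ne_top μ _) 1))).norm.integrable_sq
  rw [h1, ← integral_div, ← integral_add (integrable_const _) (hint.div_const _)]
  refine integral_mono_ae (integrable_norm_sub f g)
    ((integrable_const _).add (hint.div_const _)) ?_
  filter_upwards [mulLp_sub_mulLp_ae f g (indicatorConstLp 2 .univ (measure_ne_top μ _) 1),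
    indicatorConstLp_coeFn (p := 2) (hs := .univ) (hμs := measure_ne_top μ _) (c := (1 : ℂ))]
    with x h2 h3
  rw [h2, h3, Set.indicator_univ, mul_one, ← sub_le_iff_le_add', le_div_iff₀ hη]
  nlinarith [sq_nonneg (‖toComplex f x - toComplex g x‖ - η), norm_nonneg
    (toComplex f x - toComplex g x)]

theorem isEmbedding_mulRep : Topology.IsEmbedding (mulRep μ) := by
  have hind : Topology.IsInducing (mulRep μ) := by
    refine Topology.isInducing_iff_nhds.2 fun f => le_antisymm
      (continuous_mulRep.tendsto f).le_comap ?_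
    refine Metric.nhds_basis_ball.ge_iff.2 fun ε hε => ?_
    let one : Lp ℂ 2 μ := indicatorConstLp 2 .univ (measure_ne_top μ _) 1
    let η : ℝ := ε / (2 * (μ.real Set.univ + 1))
    have hη : 0 < η := by positivity
    have hημ : η * μ.real Set.univ < ε / 2 := by
      have : η * (μ.real Set.univ + 1) = ε / 2 := by simp only [η]; field_simp
      nlinarith
    have hc : Continuous fun U : Lp ℂ 2 μ ≃ₗᵢ[ℂ] Lp ℂ 2 μ => ‖U one - mulRep μ f one‖ ^ 2 / η :=
      (((continuous_unitary_apply one).sub continuous_const).norm.pow 2).div_const η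
    have hev : ∀ᶠ U in nhds (mulRep μ f), ‖U one - mulRep μ f one‖ ^ 2 / η < ε / 2 := by
      refine hc.continuousAt.eventually_lt continuousAt_const ?_
      simpa using hε
    refine Filter.mem_of_superset (Filter.preimage_mem_comap hev) fun g hg => ?_
    have h1 : ‖mulLp g one - mulLp f one‖ ^ 2 / η < ε / 2 := hg
    rw [Metric.mem_ball]
    have := dist_le_of_mulLp_one g f hη
    linarith
  refine ⟨hind, fun f g h => ?_⟩
  have : Inseparable f g := hind.inseparable_iff.1 (by rw [h])
  exact this.eq

theorem range_mulRep_ne_bot [NeZero μ] : (mulRep μ).range ≠ ⊥ := by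
  intro h
  have h1 : ∀ f : L1Circle μ, f = 1 := fun f => isEmbedding_mulRep.injective (by
    have : mulRep μ f ∈ (mulRep μ).range := ⟨f, rfl⟩
    rw [h, Subgroup.mem_bot] at this
    rw [this, map_one])
  have h2 := h1 (expi (fun _ => Real.pi) aemeasurable_const)
  rw [← expi_zero, expi_eq_iff] at h2
  have h3 : ∀ᵐ _ : X ∂μ, False := by
    filter_upwards [h2] with x hx
    rw [Circle.exp_zero] at hx
    have h4 := congrArg (fun z : Circle => (z : ℂ)) hx
    simp only [Circle.coe_exp, Complex.exp_pi_mul_I, Circle.coe_one] at h4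
    norm_num at h4
  rw [ae_iff] at h3
  exact NeZero.ne μ (by simpa using h3)

theorem continuous_rangeRestrict {G H : Type*} [Group G] [TopologicalSpace G]
    [NormedAddCommGroup H] [InnerProductSpace ℂ H] (π : G →* (H ≃ₗᵢ[ℂ] H)) (hπ : Continuous π) :
    Continuous π.rangeRestrict :=
  hπ.subtype_mk _

end L1Circle

theorem mulRep_properties (X : Type w) [MeasurableSpace X] [StandardBorelSpace X]
    (μ : Measure X) [IsFiniteMeasure μ] [NeZero μ] [NullSingletonClass μ] :
    TopologicalSpace.SeparableSpace (Lp ℂ 2 μ) ∧ ¬ FiniteDimensional ℂ (Lp ℂ 2 μ) ∧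
      Topology.IsEmbedding (L1Circle.mulRep μ) ∧
      (L1Circle.mulRep μ).range ≠ ⊥ ∧
      IsMonothetic (L1Circle.mulRep μ).range ∧
      HasNoNontrivialIrreducibleBanachRep.{v} (L1Circle.mulRep μ).range := by
  have hcont := L1Circle.continuous_rangeRestrict _ (L1Circle.continuous_mulRep (μ := μ))
  have : Fact ((2 : ℝ≥0∞) ≠ ∞) := ⟨by norm_num⟩
  exact ⟨inferInstance, not_finiteDimensional_Lp_two μ, L1Circle.isEmbedding_mulRep,
    L1Circle.range_mulRep_ne_bot,
    L1Circle.isMonothetic.of_surjective _ hcont (MonoidHom.rangeRestrict_surjective _),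
    L1Circle.hasNoNontrivialIrreducibleBanachRep.of_surjective _ hcont
      (MonoidHom.rangeRestrict_surjective _)⟩

/-! ### Transport to an arbitrary separable Hilbert space -/

section HilbertSpaces

/-- A separable infinite-dimensional Hilbert space has a Hilbert basis indexed by `ℕ`. -/
theorem exists_hilbertBasis_nat (H : Type*) [NormedAddCommGroup H] [InnerProductSpace ℂ H]
    [CompleteSpace H] [TopologicalSpace.SeparableSpace H] (hH : ¬ FiniteDimensional ℂ H) :
    Nonempty (HilbertBasis ℕ ℂ H) := by
  obtain ⟨w, b, hb⟩ := exists_hilbertBasis ℂ H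
  have : SecondCountableTopology H := UniformSpace.secondCountable_of_separable H
  -- Distinct orthonormal vectors are at distance `√2 ≥ 1`, so a separable space admits only
  -- countably many.
  have hdisc : DiscreteTopology w := by
    refine DiscreteTopology.of_forall_le_dist one_pos fun x y hxy => ?_
    have h1 := b.orthonormal
    have h2 : inner ℂ (x : H) y = 0 := by
      have := h1.2 hxy
      simpa [hb] using this
    have h3 : ‖(x : H)‖ = 1 := by simpa [hb] using h1.1 x
    have h4 : ‖(y : H)‖ = 1 := by simpa [hb] using h1.1 y
    change 1 ≤ dist (x : H) y
    rw [dist_eq_norm]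
    have h5 := norm_sub_sq (𝕜 := ℂ) (x : H) y
    rw [h2, h3, h4] at h5
    norm_num at h5
    nlinarith [norm_nonneg ((x : H) - y)]
  have hcount : Countable w := TopologicalSpace.separableSpace_iff_countable.1 inferInstance
  have hinf : Infinite w := by
    by_contra hfin
    rw [not_infinite_iff_finite] at hfin
    have := Fintype.ofFinite w
    exact hH (Module.Basis.finiteDimensional_of_finite b.toOrthonormalBasis.toBasis)
  obtain ⟨hden⟩ := nonempty_denumerable w
  let e : ℕ ≃ w := (Denumerable.eqv w).symm
  have hr : Set.range (b ∘ e) = Set.range b := e.surjective.range_comp b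
  exact ⟨HilbertBasis.mk (b.orthonormal.comp e e.injective) (by rw [hr, b.dense_span])⟩

theorem nonempty_linearIsometryEquiv_of_separable (H H' : Type*) [NormedAddCommGroup H]
    [InnerProductSpace ℂ H] [CompleteSpace H] [TopologicalSpace.SeparableSpace H]
    (hH : ¬ FiniteDimensional ℂ H) [NormedAddCommGroup H'] [InnerProductSpace ℂ H']
    [CompleteSpace H'] [TopologicalSpace.SeparableSpace H'] (hH' : ¬ FiniteDimensional ℂ H') :
    Nonempty (H ≃ₗᵢ[ℂ] H') := by
  obtain ⟨b⟩ := exists_hilbertBasis_nat H hH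
  obtain ⟨b'⟩ := exists_hilbertBasis_nat H' hH'
  exact ⟨b.repr.trans b'.repr.symm⟩

/-- Conjugation by a unitary equivalence. -/
def LinearIsometryEquiv.conjUnitary {H H' : Type*} [NormedAddCommGroup H]
    [InnerProductSpace ℂ H] [NormedAddCommGroup H'] [InnerProductSpace ℂ H'] (U : H ≃ₗᵢ[ℂ] H') :
    (H ≃ₗᵢ[ℂ] H) →* (H' ≃ₗᵢ[ℂ] H') where
  toFun T := (U.symm.trans T).trans U
  map_one' := LinearIsometryEquiv.ext fun x => U.apply_symm_apply x
  map_mul' S _ := LinearIsometryEquiv.ext fun _ =>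
    congrArg (fun y => U (S y)) (U.symm_apply_apply _).symm

theorem LinearIsometryEquiv.conjUnitary_injective {H H' : Type*} [NormedAddCommGroup H]
    [InnerProductSpace ℂ H] [NormedAddCommGroup H'] [InnerProductSpace ℂ H'] (U : H ≃ₗᵢ[ℂ] H') :
    Function.Injective U.conjUnitary := by
  intro S T h
  refine LinearIsometryEquiv.ext fun x => ?_
  have h1 : U (S (U.symm (U x))) = U (T (U.symm (U x))) := DFunLike.congr_fun h (U x)
  rw [U.symm_apply_apply] at h1
  exact U.injective h1

theorem LinearIsometryEquiv.continuous_conjUnitary {H H' : Type*} [NormedAddCommGroup H]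
    [InnerProductSpace ℂ H] [NormedAddCommGroup H'] [InnerProductSpace ℂ H'] (U : H ≃ₗᵢ[ℂ] H') :
    Continuous U.conjUnitary :=
  continuous_induced_rng.2 (continuous_pi fun x =>
    U.continuous.comp (L1Circle.continuous_unitary_apply (U.symm x)))

theorem L1Circle.exists_faithful_unitary_rep {X : Type*} [MeasurableSpace X]
    [StandardBorelSpace X] (μ : Measure X) [IsFiniteMeasure μ] [NeZero μ] [NullSingletonClass μ]
    (H : Type*) [NormedAddCommGroup H] [InnerProductSpace ℂ H] [CompleteSpace H]
    [TopologicalSpace.SeparableSpace H] (hH : ¬ FiniteDimensional ℂ H) :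
    ∃ π : L1Circle μ →* (H ≃ₗᵢ[ℂ] H), Continuous π ∧ Function.Injective π := by
  have : Fact ((2 : ℝ≥0∞) ≠ ∞) := ⟨by norm_num⟩
  obtain ⟨U⟩ := nonempty_linearIsometryEquiv_of_separable (Lp ℂ 2 μ) H
    (not_finiteDimensional_Lp_two μ) hH
  exact ⟨U.conjUnitary.comp (mulRep μ), U.continuous_conjUnitary.comp continuous_mulRep,
    U.conjUnitary_injective.comp isEmbedding_mulRep.injective⟩

theorem MonoidHom.range_ne_bot_of_injective {G G' : Type*} [Group G] [Nontrivial G] [Group G']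
    (f : G →* G') (hf : Function.Injective f) : f.range ≠ ⊥ := by
  intro h
  obtain ⟨g, hg⟩ := exists_ne (1 : G)
  have h1 : f g ∈ f.range := ⟨g, rfl⟩
  rw [h, Subgroup.mem_bot] at h1
  exact hg (hf (h1.trans f.map_one.symm))

theorem exists_subgroup_without_irreducible_rep (H : Type u) [NormedAddCommGroup H]
    [InnerProductSpace ℂ H] [CompleteSpace H] [TopologicalSpace.SeparableSpace H]
    (hH : ¬ FiniteDimensional ℂ H) :
    ∃ G : Subgroup (H ≃ₗᵢ[ℂ] H),
      G ≠ ⊥ ∧ IsMonothetic G ∧ HasNoNontrivialIrreducibleBanachRep.{v} G := by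
  -- Any nonatomic probability measure on a standard Borel space would serve here.
  let μ : Measure ℝ := ProbabilityTheory.gaussianReal 0 1
  have : NullSingletonClass μ := ProbabilityTheory.nullSingletonClass_gaussianReal one_ne_zero
  obtain ⟨π, hπ, hinj⟩ := L1Circle.exists_faithful_unitary_rep μ H hH
  have hcont := L1Circle.continuous_rangeRestrict π hπ
  have hnt : Nontrivial (L1Circle μ) := by
    by_contra h
    rw [not_nontrivial_iff_subsingleton] at h
    refine L1Circle.range_mulRep_ne_bot (μ := μ) ((Subgroup.eq_bot_iff_forall _).2 ?_)
    rintro _ ⟨f, rfl⟩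
    rw [Subsingleton.elim f 1, map_one]
  exact ⟨π.range, π.range_ne_bot_of_injective hinj,
    L1Circle.isMonothetic.of_surjective _ hcont π.rangeRestrict_surjective,
    L1Circle.hasNoNontrivialIrreducibleBanachRep.of_surjective _ hcont
      π.rangeRestrict_surjective⟩

end HilbertSpaces

/-! ### Quotients of real normed spaces by subgroups -/

section NormedQuotients

variable {E : Type*} [NormedAddCommGroup E] [NormedSpace ℝ E]

/-- Characters of a real normed space come from continuous linear functionals. -/
theorem exists_clm_of_character (χ : E → Circle) (hχ : Continuous χ)
    (hadd : ∀ x y, χ (x + y) = χ x * χ y) :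
    ∃ f : E →L[ℝ] ℝ, ∀ x, χ x = Circle.exp (f x) := by
  have h0 : χ 0 = 1 := by
    have := hadd 0 0
    rw [add_zero] at this
    exact left_eq_mul.mp this
  -- The character lifts through the covering `Circle.exp` because `E` is simply connected;
  -- uniqueness of lifts agreeing at the origin makes the lift additive.
  obtain ⟨F, ⟨hF0, hF⟩, -⟩ := Circle.isCoveringMap_exp.existsUnique_continuousMap_lifts
    ⟨χ, hχ⟩ 0 0 (by simp [h0])
  have hF' : ∀ x, Circle.exp (F x) = χ x := fun x => congrFun hF x
  have hFadd : (fun q : E × E => F (q.1 + q.2)) = fun q : E × E => F q.1 + F q.2 := by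
    refine Circle.isCoveringMap_exp.eq_of_comp_eq (by fun_prop) (by fun_prop) ?_ (0, 0) ?_
    · funext q
      simp [Circle.exp_add, hF', hadd]
    · simp [hF0]
  let f : E →+ ℝ := AddMonoidHom.mk' F fun x y => congrFun hFadd (x, y)
  exact ⟨f.toRealLinearMap F.continuous, fun x => (hF' x).symm⟩

/-- The character of `E ⧸ D` given by a functional with values in `2 π ℤ` on `D`. -/
noncomputable def quotientCharacter (D : AddSubgroup E) (f : E →L[ℝ] ℝ)
    (hf : ∀ d ∈ D, Circle.exp (f d) = 1) : Multiplicative (E ⧸ D) →* Circle :=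
  AddMonoidHom.toMultiplicativeLeft (QuotientAddGroup.lift D
    (AddMonoidHom.mk' (fun x => Additive.ofMul (Circle.exp (f x))) fun x y => by
      rw [map_add, Circle.exp_add]; rfl) fun d hd => congrArg Additive.ofMul (hf d hd))

theorem continuous_quotientCharacter (D : AddSubgroup E) (f : E →L[ℝ] ℝ)
    (hf : ∀ d ∈ D, Circle.exp (f d) = 1) : Continuous (quotientCharacter D f hf) :=
  continuous_quot_lift _
    (Circle.exp.continuous.comp f.continuous)

/-- Otherwise some functional vanishes on `D` and equals `π` at a point; its exponential descends to
a character taking the value `-1`. -/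
theorem dense_span_of_isMinimallyAlmostPeriodic (D : AddSubgroup E)
    (h : IsMinimallyAlmostPeriodic (Multiplicative (E ⧸ D))) :
    (Submodule.span ℝ (D : Set E)).topologicalClosure = ⊤ := by
  by_contra hne
  let p := (Submodule.span ℝ (D : Set E)).topologicalClosure
  have hp : IsClosed (p : Set E) := Submodule.isClosed_topologicalClosure _
  obtain ⟨x, -, hx⟩ := SetLike.exists_of_lt (lt_top_iff_ne_top.2 hne)
  have hx' : p.mkQ x ≠ 0 := by simpa using hx
  obtain ⟨g, hg⟩ := SeparatingDual.exists_eq_one (R := ℝ) hx'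
  let f : E →L[ℝ] ℝ := Real.pi • (g.comp p.mkQL)
  have hfx : f x = Real.pi := by
    change Real.pi * g (p.mkQ x) = Real.pi
    rw [hg, mul_one]
  have hf : ∀ d ∈ D, Circle.exp (f d) = 1 := by
    intro d hd
    have h1 : p.mkQ d = 0 := by
      rw [Submodule.mkQ_apply, Submodule.Quotient.mk_eq_zero]
      exact Submodule.le_topologicalClosure _ (Submodule.subset_span hd)
    have h2 : f d = 0 := by
      change Real.pi * g (p.mkQ d) = 0
      rw [h1, map_zero, mul_zero]
    rw [h2, Circle.exp_zero]
  have h1 := DFunLike.congr_fun (h _ (continuous_quotientCharacter D f hf))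
    (Multiplicative.ofAdd (x : E ⧸ D))
  have h2 : Circle.exp (f x) = 1 := h1
  rw [hfx] at h2
  have h4 := congrArg (fun z : Circle => (z : ℂ)) h2
  simp only [Circle.coe_exp, Complex.exp_pi_mul_I, Circle.coe_one] at h4
  norm_num at h4

/-- The vectors whose whole line lies in `S` form a closed linear subspace containing `D`. -/
theorem eq_top_of_forall_smul_mem (D : AddSubgroup E)
    (hD : (Submodule.span ℝ (D : Set E)).topologicalClosure = ⊤) (S : AddSubgroup E)
    (hS : IsClosed (S : Set E)) (hmem : ∀ d ∈ D, ∀ t : ℝ, t • d ∈ S) : S = ⊤ := by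
  let M : Submodule ℝ E :=
    { carrier := {x | ∀ t : ℝ, t • x ∈ S}
      zero_mem' := fun t => by rw [smul_zero]; exact S.zero_mem
      add_mem' := fun hx hy t => by rw [smul_add]; exact S.add_mem (hx t) (hy t)
      smul_mem' := fun c x hx t => by rw [smul_smul]; exact hx _ }
  have hM : IsClosed (M : Set E) := by
    have : (M : Set E) = ⋂ t : ℝ, (fun x : E => t • x) ⁻¹' S := by
      ext x
      simp [M]
    rw [this]
    exact isClosed_iInter fun t => hS.preimage (continuous_const_smul t)
  have h1 : (⊤ : Submodule ℝ E) ≤ M := by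
    rw [← hD]
    exact Submodule.topologicalClosure_minimal _ (Submodule.span_le.2 fun d hd t => hmem d hd t) hM
  rw [eq_top_iff]
  intro x _
  have := h1 (Submodule.mem_top : x ∈ ⊤) 1
  rwa [one_smul] at this

theorem hasNoNontrivialIrreducibleBanachRep_quotient {E : Type u} [NormedAddCommGroup E]
    [NormedSpace ℝ E] (D : AddSubgroup E)
    (h : IsMinimallyAlmostPeriodic (Multiplicative (E ⧸ D))) :
    HasNoNontrivialIrreducibleBanachRep.{v} (Multiplicative (E ⧸ D)) := by
  refine hasNoNontrivialIrreducibleBanachRep_of_circles h fun S hcl hS => ?_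
  let q : E →+ E ⧸ D := QuotientAddGroup.mk' D
  have hq : Continuous q := QuotientAddGroup.continuous_mk
  let S' : AddSubgroup E := S.toAddSubgroup'.comap q
  have hS' : IsClosed (S' : Set E) := hcl.preimage hq
  have htop := eq_top_of_forall_smul_mem D (dense_span_of_isMinimallyAlmostPeriodic D h) S' hS'
    (fun d hd t => ?_)
  · rw [eq_top_iff]
    intro g _
    obtain ⟨x, hx⟩ := QuotientAddGroup.mk'_surjective D g.toAdd
    have h1 : x ∈ S' := htop ▸ AddSubgroup.mem_top x
    have h2 : Multiplicative.ofAdd (q x) ∈ S := h1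
    rwa [hx] at h2
  -- For `d ∈ D` the line `s ↦ s • d` is trivial in the quotient at `s = 1`, so it closes up to a
  -- circle subgroup.
  · let c : ℝ →+ E ⧸ D := AddMonoidHom.mk' (fun s : ℝ => q (s • d)) fun a b => by
      rw [add_smul, map_add]
    have hc : AddSubgroup.zmultiples (1 : ℝ) ≤ c.ker := by
      rw [AddSubgroup.zmultiples_le]
      change q ((1 : ℝ) • d) = 0
      rw [one_smul]
      exact (QuotientAddGroup.eq_zero_iff d).2 hd
    let γ : UnitAddCircle →+ E ⧸ D := QuotientAddGroup.lift _ c hc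
    have hγ : Continuous γ := continuous_quot_lift _
      (hq.comp (by fun_prop : Continuous fun s : ℝ => s • d))
    exact hS (fun t => Multiplicative.ofAdd (γ t)) (continuous_ofAdd.comp hγ)
      (fun a b => by rw [map_add]; rfl) (t : UnitAddCircle)

theorem isMonothetic_quotient [CompleteSpace E] [SecondCountableTopology E] (D : AddSubgroup E)
    (h : IsMinimallyAlmostPeriodic (Multiplicative (E ⧸ D))) :
    IsMonothetic (Multiplicative (E ⧸ D)) := by
  let q : E →+ E ⧸ D := QuotientAddGroup.mk' D
  have hq : IsOpenQuotientMap fun x : E => Multiplicative.ofAdd (q x) :=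
    QuotientAddGroup.isOpenQuotientMap_mk
  have : BaireSpace (Multiplicative (E ⧸ D)) := hq.baireSpace
  have : SecondCountableTopology (Multiplicative (E ⧸ D)) :=
    inferInstanceAs (SecondCountableTopology (E ⧸ D))
  have : ContinuousMul (Multiplicative (E ⧸ D)) := inferInstance
  refine isMonothetic_of_dense_torsion ?_ ?_
  -- `Q` is the preimage of the torsion subgroup. It contains the rational multiples of `D`, so its
  -- closure contains every line through `D`.
  · let Q : AddSubgroup E :=
      { carrier := {x | ∃ k : ℕ, 0 < k ∧ k • x ∈ D}
        zero_mem' := ⟨1, one_pos, by simp⟩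
        add_mem' := by
          rintro x y ⟨k, hk, hx⟩ ⟨l, hl, hy⟩
          refine ⟨k * l, Nat.mul_pos hk hl, ?_⟩
          rw [smul_add]
          refine D.add_mem ?_ ?_
          · rw [mul_comm, mul_smul]; exact D.nsmul_mem hx l
          · rw [mul_smul]; exact D.nsmul_mem hy k
        neg_mem' := by
          rintro x ⟨k, hk, hx⟩
          exact ⟨k, hk, by rw [smul_neg]; exact D.neg_mem hx⟩ }
    have hQ := eq_top_of_forall_smul_mem D (dense_span_of_isMinimallyAlmostPeriodic D h)
      Q.topologicalClosure Q.isClosed_topologicalClosure fun d hd t => by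
        refine map_mem_closure (f := fun t : ℝ => t • d) (by fun_prop)
          (Rat.denseRange_cast (𝕜 := ℝ) t) ?_
        rintro _ ⟨r, rfl⟩
        refine ⟨r.den, r.den_pos, ?_⟩
        have : r.den • ((r : ℝ) • d) = r.num • d := by
          rw [← Nat.cast_smul_eq_nsmul ℝ, smul_smul, ← Int.cast_smul_eq_zsmul ℝ]
          congr 1
          rw [mul_comm]
          exact_mod_cast Rat.mul_den_eq_num r
        rw [this]
        exact D.zsmul_mem hd _
    have hQd : Dense (Q : Set E) := fun x => by
      have : x ∈ Q.topologicalClosure := hQ ▸ AddSubgroup.mem_top x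
      exact this
    refine (hq.surjective.denseRange.dense_image hq.continuous hQd).mono ?_
    rintro _ ⟨x, ⟨k, hk, hx⟩, rfl⟩
    refine ⟨k, hk, ?_⟩
    have : k • q x = 0 := by
      rw [← map_nsmul]
      exact (QuotientAddGroup.eq_zero_iff _).2 hx
    exact congrArg Multiplicative.ofAdd this
  · intro v W hW h1 k hk
    obtain ⟨x, hx⟩ := hq.surjective v
    have hlim : Filter.Tendsto (fun n : ℕ => Multiplicative.ofAdd (q ((1 / n : ℝ) • x)))
        Filter.atTop (nhds 1) := by
      have h2 := (tendsto_one_div_atTop_nhds_zero_nat (𝕜 := ℝ)).smul_const x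
      rw [zero_smul] at h2
      have h3 := (hq.continuous.tendsto (0 : E)).comp h2
      rw [map_zero, ofAdd_zero] at h3
      exact h3
    obtain ⟨N, hN⟩ := Filter.eventually_atTop.1 (hlim.eventually_mem (hW.mem_nhds h1))
    refine ⟨k * (N + 1), dvd_mul_right _ _, _, hN (k * (N + 1)) (by nlinarith), ?_⟩
    rw [← hx, ← ofAdd_nsmul, ← map_nsmul, ← Nat.cast_smul_eq_nsmul ℝ, smul_smul,
      mul_one_div_cancel (by positivity), one_smul]

end NormedQuotients

/-! ### Quotients of `ℓ_p` -/

section SequenceSpaces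

variable {p : ℝ≥0∞} [Fact (1 ≤ p)]

theorem span_single_topologicalClosure (hp : p ≠ ∞) :
    (Submodule.span ℝ (Set.range fun i : ℕ => (lp.single p i 1 : RealLp p))).topologicalClosure =
      ⊤ := by
  rw [eq_top_iff]
  intro x _
  refine mem_closure_of_tendsto (lp.hasSum_single hp x) (.of_forall fun s => ?_)
  refine Submodule.sum_mem _ fun i _ => ?_
  have : (lp.single p i (x i) : RealLp p) = x i • lp.single p i 1 := by
    rw [← lp.single_smul]
    simp
  rw [this]
  exact Submodule.smul_mem _ _ (Submodule.subset_span ⟨i, rfl⟩)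

theorem secondCountableTopology_realLp (hp : p ≠ ∞) : SecondCountableTopology (RealLp p) := by
  have h1 : TopologicalSpace.IsSeparable
      (Submodule.span ℝ (Set.range fun i : ℕ => (lp.single p i 1 : RealLp p)) :
        Set (RealLp p)) :=
    (Set.countable_range _).isSeparable.span
  have h2 := h1.closure
  rw [← Submodule.topologicalClosure_coe, span_single_topologicalClosure hp,
    Submodule.top_coe, TopologicalSpace.isSeparable_univ_iff] at h2
  exact UniformSpace.secondCountable_of_separable _

instance : Nontrivial (RealLp p) :=
  ⟨⟨lp.single p 0 1, 0, fun h => by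
    have := congrArg (fun x : RealLp p => x 0) h
    simp at this⟩⟩

/-- If `D` were everything it would contain nonzero vectors tending to zero, against discreteness.
-/
theorem nontrivial_lpQuotient (D : AddSubgroup (RealLp p)) [DiscreteTopology D] :
    Nontrivial (LpQuotient p D) := by
  by_contra h
  rw [not_nontrivial_iff_subsingleton] at h
  have hD : ∀ x : RealLp p, x ∈ D := fun x =>
    (QuotientAddGroup.eq_zero_iff x).1 (Subsingleton.elim (α := LpQuotient p D) _ _)
  have hlim : Filter.Tendsto (fun n : ℕ => (⟨(1 / ((n : ℝ) + 1)) • lp.single p 0 1, hD _⟩ : D))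
      Filter.atTop (nhds 0) := by
    refine tendsto_subtype_rng.2 ?_
    have := (tendsto_one_div_add_atTop_nhds_zero_nat (𝕜 := ℝ)).smul_const
      (lp.single p 0 1 : RealLp p)
    rwa [zero_smul] at this
  rw [nhds_discrete, Filter.tendsto_pure] at hlim
  obtain ⟨n, hn⟩ := hlim.exists
  have h1 : (1 / ((n : ℝ) + 1)) • (lp.single p 0 1 : RealLp p) = 0 := congrArg Subtype.val hn
  have h2 := congrArg (fun x : RealLp p => x 0) h1
  simp only [lp.coeFn_smul, Pi.smul_apply, lp.single_apply_self, lp.coeFn_zero, Pi.zero_apply,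
    smul_eq_mul, mul_one] at h2
  have : (0 : ℝ) < 1 / ((n : ℝ) + 1) := by positivity
  exact this.ne' h2

theorem lpQuotient_properties (p : ℝ≥0∞) [Fact (1 ≤ p)] (hp : p ≠ ∞)
    (D : AddSubgroup (RealLp p)) (hD : DiscreteTopology D)
    (h : IsMinimallyAlmostPeriodic (LpQuotient p D)) :
    IsMonothetic (LpQuotient p D) ∧
      ∀ (H : Type u) [NormedAddCommGroup H] [InnerProductSpace ℂ H] [CompleteSpace H]
        [TopologicalSpace.SeparableSpace H] (π : LpQuotient p D →* (H ≃ₗᵢ[ℂ] H)),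
        Continuous π → Function.Injective π →
        π.range ≠ ⊥ ∧ IsMonothetic π.range ∧
          HasNoNontrivialIrreducibleBanachRep.{v} π.range := by
  have := secondCountableTopology_realLp hp
  have hmono := isMonothetic_quotient D h
  refine ⟨hmono, fun H _ _ _ _ π hπ hinj => ?_⟩
  have := nontrivial_lpQuotient D
  have hcont := L1Circle.continuous_rangeRestrict π hπ
  exact ⟨π.range_ne_bot_of_injective hinj,
    hmono.of_surjective _ hcont π.rangeRestrict_surjective,
    (hasNoNontrivialIrreducibleBanachRep_quotient D h).of_surjective _ hcont
      π.rangeRestrict_surjective⟩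

end SequenceSpaces

/-! ### Riesz products and Rademacher sums on the cube -/

section Rademacher

/-- The vertices of the discrete cube. -/
abbrev Cube (n : ℕ) : Type := Fin n → Bool

/-- The `k`-th Rademacher function on the discrete cube. -/
def rademacher {n : ℕ} (ω : Cube n) (k : Fin n) : ℝ := if ω k then 1 else -1

theorem abs_rademacher {n : ℕ} (ω : Cube n) (k : Fin n) : |rademacher ω k| = 1 := by
  unfold rademacher
  split_ifs <;> simp

/-- The sum factorizes over the coordinates of the cube. A Riesz product thus has prescribed
Rademacher coefficients `ζ k`, and it is nonnegative when `|ζ k| ≤ 1`. -/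
theorem sum_rademacher_mul_prod {n : ℕ} (ζ : Fin n → ℝ) (k : Fin n) :
    ∑ ω : Cube n, rademacher ω k * ∏ l, (1 + rademacher ω l * ζ l) = 2 ^ n * ζ k := by
  have h1 : ∀ ω : Cube n, rademacher ω k * ∏ l, (1 + rademacher ω l * ζ l) =
      ∏ l, ((if l = k then rademacher ω l else 1) * (1 + rademacher ω l * ζ l)) := by
    intro ω
    rw [Finset.prod_mul_distrib, Finset.prod_ite_eq' Finset.univ k]
    simp
  simp_rw [h1]
  have h2 := Fintype.prod_sum (ι := Fin n) (κ := fun _ => Bool)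
    (fun l b => (if l = k then (if b then (1 : ℝ) else -1) else 1) *
      (1 + (if b then (1 : ℝ) else -1) * ζ l))
  refine h2.symm.trans ?_
  have h3 : ∀ l, ∑ b : Bool, (if l = k then (if b then (1 : ℝ) else -1) else 1) *
      (1 + (if b then (1 : ℝ) else -1) * ζ l) = 2 * (if l = k then ζ l else 1) := by
    intro l
    by_cases h : l = k
    · simp [h]; ring
    · simp [h]; ring
  simp_rw [h3]
  rw [Finset.prod_mul_distrib, Finset.prod_ite_eq' Finset.univ k]
  simp

theorem sum_rademacher {n : ℕ} (k : Fin n) : ∑ ω : Cube n, rademacher ω k = 0 := by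
  simpa using sum_rademacher_mul_prod (fun _ => (0 : ℝ)) k

theorem sum_rademacher_mul {n : ℕ} (k l : Fin n) :
    ∑ ω : Cube n, rademacher ω k * rademacher ω l = if k = l then 2 ^ n else 0 := by
  -- For `ζ` supported at `l` the Riesz product is `1 + rademacher ω l`.
  have h1 := sum_rademacher_mul_prod (Pi.single l (1 : ℝ)) k
  have h2 : ∀ ω : Cube n, ∏ m, (1 + rademacher ω m * (Pi.single l (1 : ℝ) : Fin n → ℝ) m) =
      1 + rademacher ω l := by
    intro ω
    rw [Finset.prod_eq_single l]
    · simp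
    · intro m _ hm
      simp [hm]
    · simp
  simp_rw [h2, mul_add, mul_one, Finset.sum_add_distrib, sum_rademacher, zero_add] at h1
  rw [h1, Pi.single_apply]
  simp

/-- Orthogonality and Cauchy–Schwarz bound the mean of `|S|` by `√n`. As `|S| / n ≤ 1` and `P ≥ 1`,
the `P`-th power of this ratio is at most the ratio itself. The resulting gain `n ^ (-1/2)` suffices
for every `P`. -/
theorem sum_abs_rademacher_sum_rpow_le {n : ℕ} (hn : 0 < n) {P : ℝ} (hP : 1 ≤ P)
    (σ : Fin n → ℝ) (hσ : ∀ k, |σ k| = 1) :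
    ∑ ω : Cube n, |∑ k, σ k * rademacher ω k| ^ P ≤
      2 ^ n * ((n : ℝ) ^ P * (n : ℝ) ^ (-(1 / 2) : ℝ)) := by
  have hn' : (0 : ℝ) < n := by exact_mod_cast hn
  have hσ2 : ∀ k, σ k * σ k = 1 := fun k => by
    rw [← abs_mul_abs_self, hσ, one_mul]
  have hle : ∀ ω : Cube n, |∑ k, σ k * rademacher ω k| ≤ n := by
    intro ω
    refine (Finset.abs_sum_le_sum_abs _ _).trans ?_
    simp [abs_mul, hσ, abs_rademacher]
  have hsq : ∑ ω : Cube n, (∑ k, σ k * rademacher ω k) ^ 2 = 2 ^ n * n := by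
    have h1 : ∀ ω : Cube n, (∑ k, σ k * rademacher ω k) ^ 2 =
        ∑ k, ∑ l, σ k * σ l * (rademacher ω k * rademacher ω l) := by
      intro ω
      rw [pow_two, Finset.sum_mul_sum]
      refine Finset.sum_congr rfl fun k _ => Finset.sum_congr rfl fun l _ => by ring
    simp_rw [h1]
    rw [Finset.sum_comm]
    have h2 : ∀ k, ∑ ω : Cube n, ∑ l, σ k * σ l * (rademacher ω k * rademacher ω l) = 2 ^ n := by
      intro k
      rw [Finset.sum_comm]
      simp_rw [← Finset.mul_sum, sum_rademacher_mul]
      simp [hσ2]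
    simp [h2, mul_comm]
  have hl1 : ∑ ω : Cube n, |∑ k, σ k * rademacher ω k| ≤ 2 ^ n * √n := by
    have h1 := sq_sum_le_card_mul_sum_sq (s := (Finset.univ : Finset (Cube n)))
      (f := fun ω => |∑ k, σ k * rademacher ω k|)
    simp_rw [sq_abs] at h1
    rw [hsq] at h1
    refine (sq_le_sq₀ (by positivity) (by positivity)).1 ?_
    refine h1.trans (le_of_eq ?_)
    rw [mul_pow, Real.sq_sqrt hn'.le]
    simp
    ring
  have hterm : ∀ ω : Cube n, |∑ k, σ k * rademacher ω k| ^ P ≤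
      (n : ℝ) ^ P * (|∑ k, σ k * rademacher ω k| / n) := by
    intro ω
    have h1 : |∑ k, σ k * rademacher ω k| = n * (|∑ k, σ k * rademacher ω k| / n) := by
      field_simp
    have h2 : |∑ k, σ k * rademacher ω k| / n ≤ 1 := (div_le_one hn').2 (hle ω)
    have h3 : 0 ≤ |∑ k, σ k * rademacher ω k| / n := by positivity
    conv_lhs => rw [h1, Real.mul_rpow hn'.le h3]
    gcongr
    exact Real.rpow_le_self_of_le_one h3 h2 hP
  refine (Finset.sum_le_sum fun ω _ => hterm ω).trans ?_
  rw [← Finset.mul_sum, ← Finset.sum_div]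
  have h4 : (n : ℝ) ^ (-(1 / 2) : ℝ) = √n / n := by
    rw [Real.rpow_neg hn'.le, ← Real.sqrt_eq_rpow, Real.sqrt_div_self]
  rw [h4]
  calc (n : ℝ) ^ P * ((∑ ω : Cube n, |∑ k, σ k * rademacher ω k|) / n)
      ≤ (n : ℝ) ^ P * ((2 ^ n * √n) / n) := by gcongr
    _ = _ := by ring

end Rademacher

/-! ### Random rounding with mean-zero error -/

section Rounding

/-- The error made when a real number `c` is rounded to one of the two neighbouring integers,
upwards if and only if `v < fract c`. -/
noncomputable def roundErr (c v : ℝ) : ℝ := (if v < Int.fract c then 1 else 0) - Int.fract c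

theorem exists_int_roundErr_add (c v : ℝ) : ∃ z : ℤ, roundErr c v + c = z := by
  have := Int.floor_add_fract c
  unfold roundErr
  split_ifs
  · exact ⟨⌊c⌋ + 1, by push_cast; linarith⟩
  · exact ⟨⌊c⌋, by linarith⟩

theorem abs_roundErr_le (c v : ℝ) : |roundErr c v| ≤ 1 := by
  have h1 := Int.fract_nonneg c
  have h2 := Int.fract_lt_one c
  unfold roundErr
  split_ifs <;> rw [abs_le] <;> constructor <;> linarith

theorem measurable_roundErr : Measurable fun q : ℝ × ℝ => roundErr q.1 q.2 := by
  unfold roundErr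
  refine Measurable.sub (Measurable.ite ?_ measurable_const measurable_const) (by fun_prop)
  exact measurableSet_lt measurable_snd (measurable_fract.comp measurable_fst)

/-- The uniform distribution on the unit interval, as a measure on `ℝ`. -/
noncomputable def uniformUnit : Measure ℝ := volume.restrict (Set.Ico 0 1)

instance : IsProbabilityMeasure uniformUnit := ⟨by simp [uniformUnit]⟩

instance : NullSingletonClass uniformUnit := by
  unfold uniformUnit
  infer_instance

theorem integrable_one_add_mul_roundErr (ε c : ℝ) :
    Integrable (fun v => 1 + ε * roundErr c v) uniformUnit := by
  have hm : Measurable fun v => roundErr c v :=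
    measurable_roundErr.comp (measurable_const.prodMk measurable_id)
  refine (integrable_const 1).add (Integrable.const_mul ?_ ε)
  exact Integrable.of_bound hm.aestronglyMeasurable 1 (.of_forall fun v => abs_roundErr_le c v)

theorem integral_one_add_mul_roundErr (ε c : ℝ) :
    ∫ v, (1 + ε * roundErr c v) ∂uniformUnit = 1 := by
  have hm : MeasurableSet {v : ℝ | v < Int.fract c} := measurableSet_Iio
  have h1 : (fun v => 1 + ε * roundErr c v) = fun v =>
      (1 - ε * Int.fract c) + ε * ((Set.Iio (Int.fract c)).indicator (fun _ => (1 : ℝ)) v) := by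
    funext v
    unfold roundErr
    by_cases h : v < Int.fract c
    · simp [h]; ring
    · simp [h]; ring
  have hint : Integrable ((Set.Iio (Int.fract c)).indicator fun _ => (1 : ℝ)) uniformUnit :=
    (integrable_const 1).indicator measurableSet_Iio
  rw [h1, integral_add (integrable_const _) (hint.const_mul ε), integral_const_mul,
    integral_indicator_const _ measurableSet_Iio]
  have h2 : uniformUnit.real (Set.Iio (Int.fract c)) = Int.fract c := by
    rw [uniformUnit, measureReal_restrict_apply measurableSet_Iio]
    have : Set.Iio (Int.fract c) ∩ Set.Ico 0 1 = Set.Ico 0 (Int.fract c) := by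
      ext v
      simp only [Set.mem_inter_iff, Set.mem_Iio, Set.mem_Ico]
      have := Int.fract_lt_one c
      constructor
      · rintro ⟨h, h', _⟩; exact ⟨h', h⟩
      · rintro ⟨h, h'⟩; exact ⟨h', h, h'.trans this⟩
    rw [this]
    simp [Measure.real, Int.fract_nonneg]
  rw [h2]
  simp

/-- Rounding up has probability `fract c`, so the error has mean zero. Each factor has mean one, the
factors are independent, and they are nonnegative because the errors are at most one in absolute
value. -/
theorem lintegral_prod_one_add_roundErr {n : ℕ} (ε : Fin n → ℝ) (hε : ∀ k, |ε k| = 1) (c : ℝ) :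
    ∫⁻ v : Fin n → ℝ, ENNReal.ofReal (∏ k, (1 + ε k * roundErr c (v k)))
      ∂(Measure.pi fun _ => uniformUnit) = 1 := by
  have hnn : ∀ v : Fin n → ℝ, 0 ≤ ∏ k, (1 + ε k * roundErr c (v k)) := fun v =>
    Finset.prod_nonneg fun k _ => by
      have h1 : |ε k * roundErr c (v k)| ≤ 1 := by
        rw [abs_mul, hε, one_mul]
        exact abs_roundErr_le _ _
      linarith [(abs_le.1 h1).1]
  rw [← ofReal_integral_eq_lintegral_ofReal (Integrable.fintype_prod fun k =>
      integrable_one_add_mul_roundErr (ε k) c) (.of_forall hnn),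
    integral_fintype_prod_eq_prod (𝕜 := ℝ) (fun k v => 1 + ε k * roundErr c v)]
  simp [integral_one_add_mul_roundErr]

end Rounding

section Resampling

/-- Resampling one coordinate preserves a product measure. -/
theorem map_update_infinitePi {ι : Type*} [DecidableEq ι] {X : ι → Type*}
    [∀ i, MeasurableSpace (X i)] (μ : ∀ i, Measure (X i)) [∀ i, IsProbabilityMeasure (μ i)]
    (j : ι) :
    ((Measure.infinitePi μ).prod (μ j)).map (fun q => Function.update q.1 j q.2) =
      Measure.infinitePi μ := by
  have hm : Measurable fun q : (∀ i, X i) × X j => Function.update q.1 j q.2 :=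
    measurable_update'
  refine Measure.eq_infinitePi μ fun s t ht => ?_
  rw [Measure.map_apply hm (.pi s.countable_toSet fun i _ => ht i)]
  have hpre : (fun q : (∀ i, X i) × X j => Function.update q.1 j q.2) ⁻¹' (s : Set ι).pi t =
      ((s.erase j : Finset ι) : Set ι).pi t ×ˢ (if j ∈ s then t j else Set.univ) := by
    ext ⟨u, v⟩
    simp only [Set.mem_preimage, Set.mem_pi, Finset.mem_coe, Set.mem_prod, Finset.mem_erase]
    constructor
    · intro h
      refine ⟨fun i hi => ?_, ?_⟩
      · have := h i hi.2
        rwa [Function.update_of_ne hi.1] at this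
      · split_ifs with hj
        · have := h j hj
          rwa [Function.update_self] at this
        · trivial
    · rintro ⟨h1, h2⟩ i hi
      by_cases hij : i = j
      · subst hij
        rw [if_pos hi] at h2
        rwa [Function.update_self]
      · rw [Function.update_of_ne hij]
        exact h1 i ⟨hij, hi⟩
  rw [hpre, Measure.prod_prod, Measure.infinitePi_pi μ fun i _ => ht i]
  by_cases hj : j ∈ s
  · rw [if_pos hj, Finset.prod_erase_mul _ _ hj]
  · rw [if_neg hj, measure_univ, mul_one, Finset.erase_eq_of_notMem hj]

/-- Allows the noise of one window to be integrated out while the noise of all others stays fixed.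
-/
theorem lintegral_infinitePi_resample {ι : Type*} [DecidableEq ι] {X : ι → Type*}
    [∀ i, MeasurableSpace (X i)]
    (μ : ∀ i, Measure (X i)) [∀ i, IsProbabilityMeasure (μ i)] (j : ι) {F : (∀ i, X i) → ℝ≥0∞}
    (hF : Measurable F) :
    ∫⁻ u, F u ∂(Measure.infinitePi μ) =
      ∫⁻ u, ∫⁻ v, F (Function.update u j v) ∂(μ j) ∂(Measure.infinitePi μ) := by
  have hm : Measurable fun q : (∀ i, X i) × X j => Function.update q.1 j q.2 :=
    measurable_update'
  conv_lhs => rw [← map_update_infinitePi μ j]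
  rw [lintegral_map hF hm]
  exact lintegral_prod _ (hF.comp hm).aemeasurable

end Resampling

/-! ### Random functionals on `ℓ_p` and the kernels of their exponentials -/

section RandomFunctionals

variable {p : ℝ≥0∞} [Fact (1 ≤ p)] {ι : Type*} [Countable ι] (e : ℕ ≃ ι)
  {Ω : Type*} [MeasurableSpace Ω] (μ : Measure Ω) (η : ι → Ω → ℝ)

/-- The random functional on `ℓ_p` with coefficients `η`. -/
noncomputable def randomFunctional (x : RealLp p) (u : Ω) : ℝ := ∑' a, x (e.symm a) * η a u

/-- The random coefficients `η` define a bounded operator from `ℓ_p` to `L_1`. -/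
structure IsBoundedRandomFunctional (p : ℝ≥0∞) [Fact (1 ≤ p)] : Prop where
  measurable : ∀ a, Measurable (η a)
  bound : ∃ C : NNReal, ∀ x : RealLp p,
    ∫⁻ u, ∑' a, ‖x (e.symm a) * η a u‖ₑ ∂μ ≤ C * ‖x‖ₑ

theorem summable_of_tsum_enorm_ne_top {ι : Type*} {f : ι → ℝ} (h : ∑' a, ‖f a‖ₑ ≠ ∞) :
    Summable f := by
  simp only [enorm_eq_nnnorm] at h
  exact (NNReal.summable_coe.2 (ENNReal.tsum_coe_ne_top_iff_summable.1 h)).of_norm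

variable {e μ η}

theorem IsBoundedRandomFunctional.ae_summable (h : IsBoundedRandomFunctional e μ η p)
    (x : RealLp p) : ∀ᵐ u ∂μ, Summable fun a => x (e.symm a) * η a u := by
  obtain ⟨C, hC⟩ := h.bound
  have hm : Measurable fun u => ∑' a, ‖x (e.symm a) * η a u‖ₑ :=
    Measurable.tsum fun a => ((h.measurable a).const_mul _).enorm
  filter_upwards [ae_lt_top hm ((hC x).trans_lt
    (ENNReal.mul_lt_top ENNReal.coe_lt_top enorm_lt_top)).ne] with u hu
  exact summable_of_tsum_enorm_ne_top hu.ne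

theorem IsBoundedRandomFunctional.aemeasurable (h : IsBoundedRandomFunctional e μ η p)
    (x : RealLp p) : AEMeasurable (randomFunctional e η x) μ := by
  refine aemeasurable_of_tendsto_metrizable_ae (Filter.atTop : Filter (Finset ι))
    (f := fun s u => ∑ a ∈ s, x (e.symm a) * η a u) (fun s =>
      (Finset.measurable_fun_sum s fun a _ => (h.measurable a).const_mul _).aemeasurable) ?_
  filter_upwards [h.ae_summable x] with u hu
  exact hu.hasSum

theorem IsBoundedRandomFunctional.add_ae (h : IsBoundedRandomFunctional e μ η p)
    (x y : RealLp p) : ∀ᵐ u ∂μ, randomFunctional e η (x + y) u =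
      randomFunctional e η x u + randomFunctional e η y u := by
  filter_upwards [h.ae_summable x, h.ae_summable y] with u hx hy
  rw [randomFunctional, randomFunctional, randomFunctional, ← hx.tsum_add hy]
  simp only [lp.coeFn_add, Pi.add_apply, add_mul]

theorem IsBoundedRandomFunctional.sub_ae (h : IsBoundedRandomFunctional e μ η p)
    (x y : RealLp p) : ∀ᵐ u ∂μ, randomFunctional e η (x - y) u =
      randomFunctional e η x u - randomFunctional e η y u := by
  filter_upwards [h.ae_summable x, h.ae_summable y] with u hx hy
  rw [randomFunctional, randomFunctional, randomFunctional, ← hx.tsum_sub hy]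
  simp only [lp.coeFn_sub, Pi.sub_apply, sub_mul]

/-- The homomorphism `x ↦ exp (2 π i T x)` defined by a random functional `T`. -/
noncomputable def IsBoundedRandomFunctional.expHom (h : IsBoundedRandomFunctional e μ η p) :
    RealLp p →+ Additive (L1Circle μ) :=
  AddMonoidHom.mk' (fun x => Additive.ofMul (L1Circle.expi
    (fun u => 2 * Real.pi * randomFunctional e η x u) ((h.aemeasurable x).const_mul _))) (by
    intro x y
    refine Eq.trans ?_ (congrArg Additive.ofMul (L1Circle.expi_add
      ((h.aemeasurable x).const_mul _) ((h.aemeasurable y).const_mul _)))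
    refine congrArg Additive.ofMul (L1Circle.expi_congr ?_)
    filter_upwards [h.add_ae x y] with u hu
    rw [hu, mul_add])

theorem IsBoundedRandomFunctional.mem_ker_iff (h : IsBoundedRandomFunctional e μ η p)
    (x : RealLp p) : x ∈ h.expHom.ker ↔
      ∀ᵐ u ∂μ, ∃ z : ℤ, randomFunctional e η x u = z := by
  have h1 : x ∈ h.expHom.ker ↔ L1Circle.expi
      (fun u => 2 * Real.pi * randomFunctional e η x u) ((h.aemeasurable x).const_mul _) =
        (1 : L1Circle μ) := Iff.rfl
  rw [h1, ← L1Circle.expi_zero, L1Circle.expi_eq_iff]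
  refine Filter.eventually_congr (.of_forall fun u => ?_)
  rw [Circle.exp_eq_exp]
  refine exists_congr fun z => ?_
  rw [zero_add, mul_comm, mul_left_inj' Real.two_pi_pos.ne']

/-- The map is Lipschitz: the exponential is `1`-Lipschitz in the angle and the functional is
bounded from `ℓ_p` to `L₁`. -/
theorem IsBoundedRandomFunctional.continuous_expHom [IsFiniteMeasure μ]
    (h : IsBoundedRandomFunctional e μ η p) :
    Continuous fun x => (h.expHom x).toMul (α := L1Circle μ) := by
  obtain ⟨C, hC⟩ := h.bound
  rw [continuous_iff_continuousAt]
  intro x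
  have hle : ∀ y, dist ((h.expHom y).toMul (α := L1Circle μ)) (h.expHom x).toMul ≤
      2 * Real.pi * (C * ‖y - x‖) := by
    intro y
    have hb : ∫⁻ u, ‖randomFunctional e η (y - x) u‖ₑ ∂μ ≤ C * ‖y - x‖ₑ :=
      (lintegral_mono fun u => enorm_tsum_le_tsum_enorm).trans (hC _)
    have hint : Integrable (randomFunctional e η (y - x)) μ :=
      ⟨(h.aemeasurable _).aestronglyMeasurable,
        hb.trans_lt (ENNReal.mul_lt_top ENNReal.coe_lt_top enorm_lt_top)⟩
    have h1 : ∫ u, ‖randomFunctional e η (y - x) u‖ ∂μ ≤ C * ‖y - x‖ := by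
      rw [integral_norm_eq_lintegral_enorm hint.aestronglyMeasurable]
      refine ENNReal.toReal_le_of_le_ofReal (by positivity) (hb.trans (le_of_eq ?_))
      rw [ENNReal.ofReal_mul C.coe_nonneg, ENNReal.ofReal_coe_nnreal, ofReal_norm]
    refine le_trans (le_of_eq (L1Circle.dist_expi ((h.aemeasurable y).const_mul _)
      ((h.aemeasurable x).const_mul _))) ?_
    refine le_trans ?_ (mul_le_mul_of_nonneg_left h1 Real.two_pi_pos.le)
    rw [← integral_const_mul]
    refine integral_mono_of_nonneg (.of_forall fun _ => norm_nonneg _)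
      (hint.norm.const_mul _) ?_
    filter_upwards [h.sub_ae y x] with u hu
    refine (Circle.norm_exp_sub_exp_le _ _).trans (le_of_eq ?_)
    rw [hu, ← mul_sub, abs_mul, abs_of_pos Real.two_pi_pos, Real.norm_eq_abs]
  refine tendsto_iff_dist_tendsto_zero.2 (squeeze_zero (fun _ => dist_nonneg) hle ?_)
  apply Continuous.tendsto' (by fun_prop)
  simp

/-- The quotient by the kernel maps injectively and continuously into `L1Circle μ`, and faithful
representations of the latter are composed with this map. -/
theorem IsBoundedRandomFunctional.exists_faithful_unitary_rep [StandardBorelSpace Ω]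
    [IsFiniteMeasure μ] [NeZero μ] [NullSingletonClass μ]
    (h : IsBoundedRandomFunctional e μ η p) (H : Type*) [NormedAddCommGroup H]
    [InnerProductSpace ℂ H] [CompleteSpace H] [TopologicalSpace.SeparableSpace H]
    (hH : ¬ FiniteDimensional ℂ H) :
    ∃ π : LpQuotient p h.expHom.ker →* (H ≃ₗᵢ[ℂ] H), Continuous π ∧ Function.Injective π := by
  obtain ⟨π, hπ, hinj⟩ := L1Circle.exists_faithful_unitary_rep μ H hH
  let θ : LpQuotient p h.expHom.ker →* L1Circle μ :=
    AddMonoidHom.toMultiplicativeLeft (QuotientAddGroup.kerLift h.expHom)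
  have hθ : Continuous θ := continuous_quot_lift _ h.continuous_expHom
  exact ⟨π.comp θ, hπ.comp hθ, hinj.comp (QuotientAddGroup.kerLift_injective h.expHom)⟩

end RandomFunctionals

/-! ### Recursive random coefficients on the windows -/

section CubeCoefficients

/-- Pairs of a window `W` and a vertex of the cube of dimension `n W`. -/
abbrev CubeIdx (n : ℕ → ℕ) : Type := Σ W, Cube (n W)

/-- A window together with a deterministic functional on it. -/
abbrev CubeRoot (n : ℕ → ℕ) : Type := Σ W, (Cube (n W) → ℝ)

/-- The space of noise variables: one for each window and each dimension of its cube. -/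
abbrev CubeNoise (n : ℕ → ℕ) : Type := (W : ℕ) → (Fin (n W) → ℝ)

variable {n : ℕ → ℕ} (κ : ℕ → ℝ) (e : ℕ ≃ CubeIdx n)

/-- The coordinate linked to the window `W`. Each coordinate is linked to infinitely many
windows. -/
def cubeParent (W : ℕ) : CubeIdx n := e (Nat.unpair W).1

/-- The coefficients of the random functional with a given root: it vanishes on the windows before
the root, it is the given functional there, and afterwards it is a Riesz product that produces
rounding errors on the Rademacher functions. -/
noncomputable def cubeCoeff (r : CubeRoot n) (u : CubeNoise n) (a : CubeIdx n) : ℝ :=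
  if a.1 < r.1 then 0
  else if h : a.1 = r.1 then r.2 (h ▸ a.2)
  else 1 / (κ a.1 * 2 ^ n a.1) * (∏ k, (1 + rademacher a.2 k * roundErr
    (if _ : (cubeParent e a.1).1 < a.1 then
      1 / ((a.1 : ℝ) + 1) * cubeCoeff r u (cubeParent e a.1) else 0) (u a.1 k)) - 1)
termination_by a.1

/-- The number that is rounded in the window `W`. -/
noncomputable def cubeShift (r : CubeRoot n) (u : CubeNoise n) (W : ℕ) : ℝ :=
  if (cubeParent e W).1 < W then 1 / ((W : ℝ) + 1) * cubeCoeff κ e r u (cubeParent e W) else 0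

variable {κ e} {r : CubeRoot n} {u : CubeNoise n}

theorem cubeCoeff_of_lt {a : CubeIdx n} (h : a.1 < r.1) : cubeCoeff κ e r u a = 0 := by
  rw [cubeCoeff, if_pos h]

theorem cubeCoeff_root (ω : Cube (n r.1)) : cubeCoeff κ e r u ⟨r.1, ω⟩ = r.2 ω := by
  rw [cubeCoeff, if_neg (lt_irrefl _), dif_pos rfl]

theorem cubeCoeff_of_gt {a : CubeIdx n} (h : r.1 < a.1) : cubeCoeff κ e r u a =
    1 / (κ a.1 * 2 ^ n a.1) *
      (∏ k, (1 + rademacher a.2 k * roundErr (cubeShift κ e r u a.1) (u a.1 k)) - 1) := by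
  rw [cubeCoeff, if_neg h.not_gt, dif_neg h.ne']
  simp only [cubeShift, dite_eq_ite]

theorem cubeShift_eq_zero {W : ℕ} (h : W ≤ r.1) : cubeShift κ e r u W = 0 := by
  unfold cubeShift
  split_ifs with h1
  · rw [cubeCoeff_of_lt (h1.trans_le h), mul_zero]
  · rfl

/-- The functional is integral on the lattice vectors linking the window `W` with its parent. -/
theorem exists_int_cubeCoeff_link (hκ : ∀ W, κ W ≠ 0)
    (hr : ∀ k, ∃ z : ℤ, κ r.1 * ∑ ω, rademacher ω k * r.2 ω = z) (W : ℕ) (k : Fin (n W)) :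
    ∃ z : ℤ, κ W * ∑ ω, rademacher ω k * cubeCoeff κ e r u ⟨W, ω⟩ + cubeShift κ e r u W = z := by
  rcases lt_trichotomy W r.1 with h | rfl | h
  · refine ⟨0, ?_⟩
    rw [cubeShift_eq_zero h.le]
    simp [cubeCoeff_of_lt (a := (⟨W, _⟩ : CubeIdx n)) h]
  -- At the root the shift is zero, since a parent in an earlier window has coefficient zero;
  -- integrality is then the hypothesis on the root.
  · rw [cubeShift_eq_zero le_rfl]
    simp_rw [cubeCoeff_root, add_zero]
    exact hr k
  · obtain ⟨z, hz⟩ := exists_int_roundErr_add (cubeShift κ e r u W) (u W k)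
    refine ⟨z, ?_⟩
    rw [← hz]
    congr 1
    -- Past the root, the scaled Rademacher coefficient of the Riesz product is exactly the rounding
    -- error; the subtracted constant is orthogonal to the Rademacher functions.
    have h1 : ∀ ω : Cube (n W), rademacher ω k * cubeCoeff κ e r u ⟨W, ω⟩ =
        1 / (κ W * 2 ^ n W) * (rademacher ω k *
          ∏ l, (1 + rademacher ω l * roundErr (cubeShift κ e r u W) (u W l)) -
            rademacher ω k) := by
      intro ω
      rw [cubeCoeff_of_gt (a := (⟨W, ω⟩ : CubeIdx n)) h]
      ring
    simp_rw [h1]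
    rw [← Finset.mul_sum, Finset.sum_sub_distrib, sum_rademacher, sub_zero,
      sum_rademacher_mul_prod (fun l => roundErr (cubeShift κ e r u W) (u W l)) k]
    have := hκ W
    field_simp

theorem measurable_cubeCoeff (r : CubeRoot n) (a : CubeIdx n) :
    Measurable fun u : CubeNoise n => cubeCoeff κ e r u a := by
  obtain ⟨W, ω⟩ := a
  induction W using Nat.strong_induction_on with
  | _ W ih =>
    rcases lt_trichotomy W r.1 with h | rfl | h
    · simp only [cubeCoeff_of_lt (a := (⟨W, ω⟩ : CubeIdx n)) h]
      exact measurable_const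
    · simp only [cubeCoeff_root]
      exact measurable_const
    · simp only [cubeCoeff_of_gt (a := (⟨W, ω⟩ : CubeIdx n)) h]
      have hs : Measurable fun u : CubeNoise n => cubeShift κ e r u W := by
        unfold cubeShift
        split_ifs with h1
        · exact (ih _ h1 _).const_mul _
        · exact measurable_const
      refine ((Finset.measurable_fun_prod _ fun k _ => ?_).sub_const 1).const_mul _
      refine ((measurable_roundErr.comp (hs.prodMk ?_)).const_mul _).const_add 1
      exact (measurable_pi_apply k).comp (measurable_pi_apply W)

theorem measurable_cubeShift (r : CubeRoot n) (W : ℕ) :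
    Measurable fun u : CubeNoise n => cubeShift κ e r u W := by
  unfold cubeShift
  split_ifs with h1
  · exact (measurable_cubeCoeff _ _).const_mul _
  · exact measurable_const

theorem cubeCoeff_congr {u u' : CubeNoise n} (a : CubeIdx n) (h : ∀ W ≤ a.1, u W = u' W) :
    cubeCoeff κ e r u a = cubeCoeff κ e r u' a := by
  obtain ⟨W, ω⟩ := a
  induction W using Nat.strong_induction_on with
  | _ W ih =>
    rcases lt_trichotomy W r.1 with h1 | rfl | h1
    · rw [cubeCoeff_of_lt h1, cubeCoeff_of_lt h1]
    · rw [cubeCoeff_root, cubeCoeff_root]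
    · rw [cubeCoeff_of_gt h1, cubeCoeff_of_gt h1]
      have hs : cubeShift κ e r u W = cubeShift κ e r u' W := by
        unfold cubeShift
        split_ifs with h2
        · exact congrArg _ (ih _ h2 _ fun W' hW' => h W' (hW'.trans h2.le))
        · rfl
      simp only [hs, h W le_rfl]

theorem cubeShift_update (u : CubeNoise n) (W : ℕ) (v : Fin (n W) → ℝ) :
    cubeShift κ e r (Function.update u W v) W = cubeShift κ e r u W := by
  unfold cubeShift
  split_ifs with h
  · rw [cubeCoeff_congr]
    intro W' hW'
    exact Function.update_of_ne (hW'.trans_lt h).ne _ _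
  · rfl

/-- The distribution of the noise. -/
noncomputable def noiseMeasure (n : ℕ → ℕ) : Measure (CubeNoise n) :=
  Measure.infinitePi fun _ => Measure.pi fun _ => uniformUnit

instance : IsProbabilityMeasure (noiseMeasure n) := by
  unfold noiseMeasure
  infer_instance

/-- The noise of the first window alone already has no atoms, provided its cube has positive
dimension. -/
theorem nullSingletonClass_noiseMeasure (hn : 0 < n 0) : NullSingletonClass (noiseMeasure n) := by
  refine ⟨fun u => ?_⟩
  have h0 : NullSingletonClass (Measure.pi fun _ : Fin (n 0) => uniformUnit) :=
    Measure.pi_nullSingletonClass ⟨0, hn⟩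
  have h1 := (measurePreserving_eval_infinitePi
    (fun W => Measure.pi fun _ : Fin (n W) => uniformUnit) 0).measure_preimage
      (measurableSet_singleton (u 0)).nullMeasurableSet
  rw [measure_singleton] at h1
  exact measure_mono_null (fun v hv => by rw [hv]; rfl) h1

/-- The shift of a window depends only on earlier noise, so resampling the noise of the window gives
its Riesz product mean one; the subtracted `1` accounts for the factor `2`. Before the root the
coefficient is zero. -/
theorem lintegral_enorm_cubeCoeff_le (hκ : ∀ W, 0 < κ W) {a : CubeIdx n} (ha : a.1 ≠ r.1) :
    ∫⁻ u, ‖cubeCoeff κ e r u a‖ₑ ∂(noiseMeasure n) ≤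
      ENNReal.ofReal (2 / (κ a.1 * 2 ^ n a.1)) := by
  rcases ha.lt_or_gt with h | h
  · simp [cubeCoeff_of_lt h]
  · have hpos : 0 < κ a.1 * 2 ^ n a.1 := mul_pos (hκ _) (by positivity)
    let F : CubeNoise n → ℝ := fun u =>
      ∏ k, (1 + rademacher a.2 k * roundErr (cubeShift κ e r u a.1) (u a.1 k))
    have hF : Measurable F := by
      refine Finset.measurable_fun_prod _ fun k _ => ?_
      refine ((measurable_roundErr.comp ((measurable_cubeShift r a.1).prodMk ?_)).const_mul
        _).const_add 1
      exact (measurable_pi_apply k).comp (measurable_pi_apply a.1)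
    have hnn : ∀ u, 0 ≤ F u := fun u => Finset.prod_nonneg fun k _ => by
      have h1 : |rademacher a.2 k * roundErr (cubeShift κ e r u a.1) (u a.1 k)| ≤ 1 := by
        rw [abs_mul, abs_rademacher, one_mul]
        exact abs_roundErr_le _ _
      linarith [(abs_le.1 h1).1]
    have hone : ∫⁻ u, ENNReal.ofReal (F u) ∂(noiseMeasure n) = 1 := by
      rw [noiseMeasure, lintegral_infinitePi_resample _ a.1 hF.ennreal_ofReal]
      have h2 : ∀ u : CubeNoise n, ∫⁻ v, ENNReal.ofReal (F (Function.update u a.1 v))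
          ∂(Measure.pi fun _ : Fin (n a.1) => uniformUnit) = 1 := by
        intro u
        simp only [F, cubeShift_update, Function.update_self]
        exact lintegral_prod_one_add_roundErr _ (abs_rademacher a.2) _
      simp [h2]
    have hle : ∀ u, ‖cubeCoeff κ e r u a‖ₑ ≤
        ENNReal.ofReal (1 / (κ a.1 * 2 ^ n a.1)) * (ENNReal.ofReal (F u) + 1) := by
      intro u
      rw [cubeCoeff_of_gt h, enorm_mul, Real.enorm_of_nonneg (by positivity)]
      gcongr
      refine (enorm_sub_le).trans ?_
      rw [Real.enorm_of_nonneg (hnn u)]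
      simp
    refine (lintegral_mono hle).trans ?_
    rw [lintegral_const_mul _ (hF.ennreal_ofReal.add_const 1),
      lintegral_add_right _ measurable_const, hone, lintegral_const, measure_univ, mul_one,
      one_add_one_eq_two, ← ENNReal.ofReal_ofNat, ← ENNReal.ofReal_mul (by positivity)]
    refine ENNReal.ofReal_le_ofReal (le_of_eq (by ring))

end CubeCoefficients

/-! ### Norm estimates on windows -/

section WindowEstimates

variable {p : ℝ≥0∞} {n : ℕ → ℕ}

theorem one_le_toReal_of_fact [Fact (1 ≤ p)] (hp : p ≠ ∞) : 1 ≤ p.toReal := by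
  have := ENNReal.toReal_mono hp (Fact.out : 1 ≤ p)
  simpa using this

variable (p n) in
/-- The coordinates of the normalized Rademacher vectors in the window `W`. -/
noncomputable def windowScale (W : ℕ) : ℝ :=
  32 * 2 ^ W * ((2 : ℝ) ^ n W) ^ (-(1 / p.toReal))

theorem windowScale_pos (W : ℕ) : 0 < windowScale p n W := by
  unfold windowScale
  positivity

theorem windowScale_mul_eq (W : ℕ) :
    1 / (windowScale p n W * 2 ^ n W) * ((2 : ℝ) ^ n W) ^ (1 - 1 / p.toReal) =
      1 / (32 * 2 ^ W) := by
  have hN : (0 : ℝ) < 2 ^ n W := by positivity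
  rw [windowScale, sub_eq_add_neg, Real.rpow_add hN, Real.rpow_one]
  have : (0 : ℝ) < ((2 : ℝ) ^ n W) ^ (-(1 / p.toReal)) := by positivity
  field_simp

variable [Fact (1 ≤ p)] (e : ℕ ≃ CubeIdx n)

/-- The coordinates belonging to the window `W`. -/
def windowEmbedding (W : ℕ) : Cube (n W) ↪ ℕ :=
  (Function.Embedding.sigmaMk W).trans e.symm.toEmbedding

theorem windowEmbedding_apply (W : ℕ) (ω : Cube (n W)) :
    windowEmbedding e W ω = e.symm ⟨W, ω⟩ := rfl

theorem sum_abs_window_le (hp : p ≠ ∞) (x : RealLp p) (W : ℕ) :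
    ∑ ω : Cube (n W), |x (e.symm ⟨W, ω⟩)| ≤ ((2 : ℝ) ^ n W) ^ (1 - 1 / p.toReal) * ‖x‖ := by
  have hP := one_le_toReal_of_fact hp
  have hP0 : 0 < p.toReal := by linarith
  have h1 := Real.rpow_sum_le_const_mul_sum_rpow_of_nonneg
    (Finset.univ : Finset (Cube (n W))) hP (f := fun ω => |x (e.symm ⟨W, ω⟩)|)
    (fun _ _ => abs_nonneg _)
  have h2 := lp.sum_rpow_le_norm_rpow hP0 x (Finset.univ.map (windowEmbedding e W))
  rw [Finset.sum_map] at h2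
  have hN : (0 : ℝ) < 2 ^ n W := by positivity
  rw [← Real.rpow_le_rpow_iff (by positivity) (by positivity) hP0]
  refine (h1.trans (mul_le_mul_of_nonneg_left h2 (by positivity))).trans (le_of_eq ?_)
  rw [Real.mul_rpow (by positivity) (norm_nonneg _), ← Real.rpow_mul hN.le]
  congr 2
  · simp
  · field_simp

/-- Hölder's inequality bounds the contribution of the window `W` by `‖x‖ / 16 * (1 / 2) ^ W`. The
factor `32 * 2 ^ W` in `windowScale` is there to make these bounds sum to `‖x‖ / 8`. -/
theorem tsum_window_le (hp : p ≠ ∞) (x : RealLp p) :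
    ∑' a : CubeIdx n, ‖x (e.symm a)‖ₑ *
      ENNReal.ofReal (2 / (windowScale p n a.1 * 2 ^ n a.1)) ≤ ENNReal.ofReal (‖x‖ / 8) := by
  refine (ENNReal.tsum_sigma' _).trans_le ?_
  have h1 : ∀ W, ∑' ω : Cube (n W), ‖x (e.symm ⟨W, ω⟩)‖ₑ *
      ENNReal.ofReal (2 / (windowScale p n W * 2 ^ n W)) ≤
        ENNReal.ofReal (‖x‖ / 16 * (1 / 2) ^ W) := by
    intro W
    have hκ := windowScale_pos (p := p) (n := n) W
    rw [tsum_fintype, ← Finset.sum_mul]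
    have h2 : ∑ ω : Cube (n W), ‖x (e.symm ⟨W, ω⟩)‖ₑ =
        ENNReal.ofReal (∑ ω : Cube (n W), |x (e.symm ⟨W, ω⟩)|) := by
      rw [ENNReal.ofReal_sum_of_nonneg fun _ _ => abs_nonneg _]
      refine Finset.sum_congr rfl fun ω _ => ?_
      rw [← Real.norm_eq_abs, ofReal_norm]
    rw [h2, ← ENNReal.ofReal_mul (Finset.sum_nonneg fun _ _ => abs_nonneg _)]
    refine ENNReal.ofReal_le_ofReal ?_
    refine (mul_le_mul_of_nonneg_right (sum_abs_window_le e hp x W) (by positivity)).trans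
      (le_of_eq ?_)
    have h3 := windowScale_mul_eq (p := p) (n := n) W
    calc _ = 2 * ‖x‖ * (1 / (windowScale p n W * 2 ^ n W) *
          ((2 : ℝ) ^ n W) ^ (1 - 1 / p.toReal)) := by ring
      _ = _ := by rw [h3, one_div_pow]; field_simp; ring
  refine (ENNReal.tsum_le_tsum h1).trans (le_of_eq ?_)
  rw [← ENNReal.ofReal_tsum_of_nonneg (fun W => by positivity)
    (summable_geometric_two.mul_left _), tsum_mul_left, tsum_geometric_two]
  congr 1
  ring

theorem norm_window_sum (hp : p ≠ ∞) (W : ℕ) (c : Cube (n W) → ℝ) :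
    ‖∑ ω, c ω • (lp.single p (e.symm ⟨W, ω⟩) 1 : RealLp p)‖ ^ p.toReal =
      ∑ ω, |c ω| ^ p.toReal := by
  have hP0 : 0 < p.toReal := by linarith [one_le_toReal_of_fact hp]
  have h1 := lp.norm_sum_single (E := fun _ : ℕ => ℝ) hP0
    (Function.extend (windowEmbedding e W) c 0) (Finset.univ.map (windowEmbedding e W))
  simp only [Finset.sum_map, (windowEmbedding e W).injective.extend_apply,
    Real.norm_eq_abs] at h1
  simp only [windowEmbedding_apply] at h1
  rw [← h1]
  congr 3
  funext ω
  rw [← lp.single_smul]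
  simp

/-- The scale cancels the cardinality of the cube, leaving the gain `n W ^ (-1 / (2 p))` over the
trivial bound for a signed sum of `n W` vectors. -/
theorem norm_window_rademacher_le (hp : p ≠ ∞) {W : ℕ} (hn : 0 < n W) (σ : Fin (n W) → ℝ)
    (hσ : ∀ k, |σ k| = 1) :
    ‖∑ ω, (windowScale p n W * ∑ k, σ k * rademacher ω k) •
      (lp.single p (e.symm ⟨W, ω⟩) 1 : RealLp p)‖ ≤
      n W * (32 * 2 ^ W * (n W : ℝ) ^ (-(1 / (2 * p.toReal)))) := by
  have hP := one_le_toReal_of_fact hp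
  have hP0 : 0 < p.toReal := by linarith
  have hn' : (0 : ℝ) < n W := by exact_mod_cast hn
  have hN : (0 : ℝ) < 2 ^ n W := by positivity
  have hκ := windowScale_pos (p := p) (n := n) W
  rw [← Real.rpow_le_rpow_iff (norm_nonneg _) (by positivity) hP0, norm_window_sum e hp]
  have h1 := sum_abs_rademacher_sum_rpow_le hn hP σ hσ
  have h2 : ∀ ω : Cube (n W), |windowScale p n W * ∑ k, σ k * rademacher ω k| ^ p.toReal =
      windowScale p n W ^ p.toReal * |∑ k, σ k * rademacher ω k| ^ p.toReal := by
    intro ω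
    rw [abs_mul, abs_of_pos hκ, Real.mul_rpow hκ.le (abs_nonneg _)]
  simp_rw [h2]
  rw [← Finset.mul_sum]
  refine (mul_le_mul_of_nonneg_left h1 (by positivity)).trans (le_of_eq ?_)
  rw [windowScale, Real.mul_rpow (by positivity) (by positivity),
    Real.mul_rpow hn'.le (by positivity),
    Real.mul_rpow (x := 32 * 2 ^ W) (y := (n W : ℝ) ^ (-(1 / (2 * p.toReal))))
      (by positivity) (by positivity), ← Real.rpow_mul hN.le, ← Real.rpow_mul hn'.le]
  have h3 : -(1 / p.toReal) * p.toReal = -1 := by field_simp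
  have h4 : -(1 / (2 * p.toReal)) * p.toReal = -(1 / 2) := by field_simp
  rw [h3, h4, Real.rpow_neg_one]
  field_simp

/-- The dimension of the cube is taken large enough for this gain to absorb the factor `32 * 2 ^ W`.
-/
theorem exists_window_dim (hp : p ≠ ∞) : ∃ n : ℕ → ℕ, ∀ W, 0 < n W ∧
    32 * 2 ^ W * (n W : ℝ) ^ (-(1 / (2 * p.toReal))) ≤ 1 / ((W : ℝ) + 1) ^ 2 := by
  have hP := one_le_toReal_of_fact hp
  have h : ∀ W : ℕ, ∃ m : ℕ, 0 < m ∧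
      32 * 2 ^ W * (m : ℝ) ^ (-(1 / (2 * p.toReal))) ≤ 1 / ((W : ℝ) + 1) ^ 2 := by
    intro W
    have h1 := ((tendsto_rpow_neg_atTop (y := 1 / (2 * p.toReal)) (by positivity)).comp
      tendsto_natCast_atTop_atTop).const_mul (32 * 2 ^ W : ℝ)
    rw [mul_zero] at h1
    have h2 : (0 : ℝ) < 1 / ((W : ℝ) + 1) ^ 2 := by positivity
    obtain ⟨m, h3, h4⟩ := ((h1.eventually (ge_mem_nhds h2)).and
      (Filter.eventually_gt_atTop 0)).exists
    exact ⟨m, h4, h3⟩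
  choose n hn using h
  exact ⟨n, hn⟩

/-- A functional of bounded norm is small on some Rademacher vector of the window `W`. -/
theorem exists_small_rademacher (hp : p ≠ ∞) {W : ℕ} (hn : 0 < n W)
    (hsmall : 32 * 2 ^ W * (n W : ℝ) ^ (-(1 / (2 * p.toReal))) ≤ 1 / ((W : ℝ) + 1) ^ 2)
    (f : RealLp p →L[ℝ] ℝ) :
    ∃ k : Fin (n W), |f (∑ ω, (windowScale p n W * rademacher ω k) •
      (lp.single p (e.symm ⟨W, ω⟩) 1 : RealLp p))| ≤ ‖f‖ * (1 / ((W : ℝ) + 1) ^ 2) := by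
  let v : Fin (n W) → RealLp p := fun k => ∑ ω, (windowScale p n W * rademacher ω k) •
      (lp.single p (e.symm ⟨W, ω⟩) 1 : RealLp p)
  -- With these signs, `∑ |f (v k)|` is the value of `f` at a single signed sum, whose norm is small
  -- relative to `n W`; some term is at most the average.
  let σ : Fin (n W) → ℝ := fun k => if 0 ≤ f (v k) then 1 else -1
  have hσ : ∀ k, |σ k| = 1 := fun k => by simp only [σ]; split_ifs <;> simp
  have hσf : ∀ k, σ k * f (v k) = |f (v k)| := by
    intro k
    simp only [σ]
    split_ifs with h
    · rw [one_mul, abs_of_nonneg h]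
    · rw [abs_of_neg (not_le.1 h), neg_one_mul]
  have hv : ∑ k, σ k • v k = ∑ ω, (windowScale p n W * ∑ k, σ k * rademacher ω k) •
      (lp.single p (e.symm ⟨W, ω⟩) 1 : RealLp p) := by
    simp only [v, Finset.smul_sum]
    rw [Finset.sum_comm]
    refine Finset.sum_congr rfl fun ω _ => ?_
    rw [Finset.mul_sum, Finset.sum_smul]
    refine Finset.sum_congr rfl fun k _ => ?_
    rw [smul_smul]
    congr 1
    ring
  have hsum : ∑ k, |f (v k)| ≤ ∑ _k : Fin (n W), ‖f‖ * (1 / ((W : ℝ) + 1) ^ 2) := by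
    have h1 : ∑ k, |f (v k)| = f (∑ k, σ k • v k) := by
      rw [map_sum]
      refine Finset.sum_congr rfl fun k _ => ?_
      rw [map_smul, smul_eq_mul, hσf]
    rw [h1, hv]
    refine (le_abs_self _).trans ((f.le_opNorm _).trans ?_)
    have h2 := (norm_window_rademacher_le e hp hn σ hσ).trans
      (mul_le_mul_of_nonneg_left hsmall (by positivity))
    refine (mul_le_mul_of_nonneg_left h2 (norm_nonneg f)).trans (le_of_eq ?_)
    rw [Finset.sum_const, Finset.card_univ, Fintype.card_fin, nsmul_eq_mul]
    ring
  have : Nonempty (Fin (n W)) := ⟨⟨0, hn⟩⟩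
  obtain ⟨k, -, hk⟩ := Finset.exists_le_of_sum_le Finset.univ_nonempty hsum
  exact ⟨k, hk⟩

end WindowEstimates

/-! ### Mixing countably many random functionals -/

section Mixtures

variable {p : ℝ≥0∞} [Fact (1 ≤ p)] {ι : Type*} [Countable ι] {e : ℕ ≃ ι}
  {Ω : Type*} [MeasurableSpace Ω] {μ : Measure Ω}

/-- Countably many bounded random functionals can be combined into a single one by choosing one of
them at random. -/
theorem exists_mixture_isBoundedRandomFunctional [SFinite μ] {η : ℕ → ι → Ω → ℝ}
    (h : ∀ j, IsBoundedRandomFunctional e μ (η j) p) :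
    ∃ ν : Measure ℕ, IsFiniteMeasure ν ∧ (∀ j, ν {j} ≠ 0) ∧
      IsBoundedRandomFunctional e (ν.prod μ) (fun a q => η q.1 a q.2) p := by
  choose C hC using fun j => (h j).bound
  -- The weights make both `∑ w j` and `∑ w j * C j` at most one, so the mixing measure is finite
  -- and the mixture is bounded with constant `1`.
  let w : ℕ → ℝ≥0∞ := fun j => 2⁻¹ ^ (j + 1) / (1 + C j)
  have hC0 : ∀ j, (1 + C j : ℝ≥0∞) ≠ 0 := fun j => by positivity
  have hCt : ∀ j, (1 + C j : ℝ≥0∞) ≠ ∞ := fun j => by finiteness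
  have hw : ∀ j, w j * (1 + C j) = 2⁻¹ ^ (j + 1) := fun j =>
    ENNReal.div_mul_cancel (hC0 j) (hCt j)
  have hsum : ∑' j : ℕ, (2⁻¹ : ℝ≥0∞) ^ (j + 1) = 1 := by
    rw [ENNReal.tsum_geometric_add_one, ENNReal.one_sub_inv_two, inv_inv]
    exact ENNReal.inv_mul_cancel (by simp) (by simp)
  let ν : Measure ℕ := Measure.sum fun j => w j • Measure.dirac j
  have hν : ∀ f : ℕ → ℝ≥0∞, ∫⁻ j, f j ∂ν = ∑' j, w j * f j := fun f => by
    rw [lintegral_sum_measure]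
    simp
  have hν1 : ν Set.univ ≤ 1 := by
    have h1 := hν fun _ => 1
    rw [lintegral_one] at h1
    refine h1.trans_le (le_trans ?_ hsum.le)
    refine ENNReal.tsum_le_tsum fun j => ?_
    rw [← hw j]
    exact mul_le_mul' le_rfl le_self_add
  refine ⟨ν, ⟨hν1.trans_lt ENNReal.one_lt_top⟩, fun j => ?_, ?_, 1, fun x => ?_⟩
  · have h1 : w j ≤ ν {j} := by
      rw [Measure.sum_apply _ (measurableSet_singleton j)]
      refine le_trans ?_ (ENNReal.le_tsum j)
      simp
    have h2 : w j ≠ 0 := ENNReal.div_ne_zero.2 ⟨by simp, hCt j⟩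
    exact fun h3 => h2 (le_antisymm (h3 ▸ h1) bot_le)
  · exact fun a => measurable_from_prod_countable_right fun j => (h j).measurable a
  · have hm : Measurable fun q : ℕ × Ω => ∑' a, ‖x (e.symm a) * η q.1 a q.2‖ₑ :=
      measurable_from_prod_countable_right fun j => Measurable.tsum fun a =>
        (((h j).measurable a).const_mul _).enorm
    rw [lintegral_prod _ hm.aemeasurable, hν]
    calc ∑' j, w j * ∫⁻ u, ∑' a, ‖x (e.symm a) * η j a u‖ₑ ∂μ
        ≤ ∑' j : ℕ, 2⁻¹ ^ (j + 1) * ‖x‖ₑ := by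
          refine ENNReal.tsum_le_tsum fun j => ?_
          rw [← hw j, mul_assoc]
          gcongr
          exact (hC j x).trans (mul_le_mul_left le_add_self _)
      _ = (1 : NNReal) * ‖x‖ₑ := by rw [ENNReal.tsum_mul_right, hsum, ENNReal.coe_one]

end Mixtures

/-! ### Fluctuations outside the root window -/

section Fluctuations

variable {n : ℕ → ℕ}

theorem hasSum_window {α : Type*} [AddCommMonoid α] [TopologicalSpace α] (W : ℕ)
    (f : CubeIdx n → α) :
    HasSum (fun a => if a.1 = W then f a else 0) (∑ ω : Cube (n W), f ⟨W, ω⟩) := by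
  have h := hasSum_sum_of_ne_finset_zero (f := fun a => if a.1 = W then f a else 0)
    (s := Finset.univ.map (Function.Embedding.sigmaMk W)) (L := SummationFilter.unconditional _)
    (fun a ha => if_neg fun h1 => ha (by
      obtain ⟨V, ω⟩ := a
      subst h1
      simp))
  simpa using h

theorem tsum_eq_window_add {α : Type*} [AddCommMonoid α] [TopologicalSpace α] [T2Space α]
    [ContinuousAdd α] (W : ℕ) (f : CubeIdx n → α)
    (hf : Summable fun a => if a.1 = W then 0 else f a) :
    ∑' a, f a = ∑ ω : Cube (n W), f ⟨W, ω⟩ + ∑' a, if a.1 = W then 0 else f a := by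
  refine HasSum.tsum_eq ?_
  convert (hasSum_window W f).add hf.hasSum using 2 with a
  split_ifs <;> simp

variable {p : ℝ≥0∞} [Fact (1 ≤ p)] (e : ℕ ≃ CubeIdx n)

/-- The bound does not depend on the root, so arbitrarily large root functionals are allowed without
increasing the fluctuation. -/
theorem lintegral_tsum_off_root_le (hp : p ≠ ∞) (r : CubeRoot n) (x : RealLp p) :
    ∫⁻ u, ∑' a, (if a.1 = r.1 then 0 else
      ‖x (e.symm a) * cubeCoeff (windowScale p n) e r u a‖ₑ) ∂noiseMeasure n ≤
        ENNReal.ofReal (‖x‖ / 8) := by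
  have hm : ∀ a, Measurable fun u => ‖x (e.symm a) * cubeCoeff (windowScale p n) e r u a‖ₑ :=
    fun a => ((measurable_cubeCoeff r a).const_mul _).enorm
  rw [lintegral_tsum fun a => by
    split_ifs
    · exact aemeasurable_const
    · exact (hm a).aemeasurable]
  refine le_trans (ENNReal.tsum_le_tsum fun a => ?_) (tsum_window_le e hp x)
  split_ifs with h
  · simp
  · simp only [enorm_mul]
    rw [lintegral_const_mul _ (measurable_cubeCoeff r a).enorm]
    gcongr
    exact lintegral_enorm_cubeCoeff_le windowScale_pos h

theorem isBoundedRandomFunctional_cubeCoeff (hp : p ≠ ∞) (r : CubeRoot n) :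
    IsBoundedRandomFunctional e (noiseMeasure n)
      (fun a u => cubeCoeff (windowScale p n) e r u a) p := by
  refine ⟨measurable_cubeCoeff r, (∑ ω, ‖r.2 ω‖₊) + 1, fun x => ?_⟩
  have h0 : p ≠ 0 := (zero_lt_one.trans_le (Fact.out : 1 ≤ p)).ne'
  simp_rw [fun u => tsum_eq_window_add r.1
    (fun a => ‖x (e.symm a) * cubeCoeff (windowScale p n) e r u a‖ₑ) ENNReal.summable,
    cubeCoeff_root]
  rw [lintegral_add_left measurable_const, lintegral_const, measure_univ, mul_one,
    ENNReal.coe_add, add_mul, ENNReal.coe_one, one_mul, ENNReal.ofNNReal_finsetSum,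
    Finset.sum_mul]
  refine add_le_add (Finset.sum_le_sum fun ω _ => ?_)
    ((lintegral_tsum_off_root_le e hp r x).trans ?_)
  · rw [enorm_mul, mul_comm]
    refine mul_le_mul_right ?_ _
    exact enorm_le_iff_norm_le.2 (lp.norm_apply_le_norm h0 x _)
  · rw [← ofReal_norm]
    exact ENNReal.ofReal_le_ofReal (by linarith [norm_nonneg x])

/-- Where the random functional with a given root takes integer values, its deterministic part is
almost an integer. -/
theorem exists_int_abs_root_sub_lt (hp : p ≠ ∞) (r : CubeRoot n) {x : RealLp p} (hx : ‖x‖ ≤ 1)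
    (h : ∀ᵐ u ∂noiseMeasure n, ∃ z : ℤ,
      randomFunctional e (fun a u => cubeCoeff (windowScale p n) e r u a) x u = z) :
    ∃ z : ℤ, |∑ ω, x (e.symm ⟨r.1, ω⟩) * r.2 ω - z| < 1 / 4 := by
  by_contra! hcon
  have h1 : ∀ᵐ u ∂noiseMeasure n, ENNReal.ofReal (1 / 4) ≤ ∑' a, (if a.1 = r.1 then 0 else
      ‖x (e.symm a) * cubeCoeff (windowScale p n) e r u a‖ₑ) := by
    filter_upwards [h, (isBoundedRandomFunctional_cubeCoeff e hp r).ae_summable x] with u hz hs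
    obtain ⟨z, hz⟩ := hz
    let f : CubeIdx n → ℝ := fun a => x (e.symm a) * cubeCoeff (windowScale p n) e r u a
    have hs' : Summable fun a => if a.1 = r.1 then 0 else f a := by
      refine (hs.sub (hasSum_window r.1 f).summable).congr fun a => ?_
      split_ifs <;> simp [f]
    have h2 : (z : ℝ) = ∑ ω, x (e.symm ⟨r.1, ω⟩) * r.2 ω +
        ∑' a, if a.1 = r.1 then 0 else f a := by
      rw [← hz]
      refine (tsum_eq_window_add r.1 f hs').trans ?_
      simp only [f, cubeCoeff_root]
    have h3 : 1 / 4 ≤ ‖∑' a, if a.1 = r.1 then 0 else f a‖ := by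
      refine (hcon z).trans (le_of_eq ?_)
      rw [h2, ← norm_neg, Real.norm_eq_abs]
      congr 1
      ring
    refine (ENNReal.ofReal_le_ofReal h3).trans ?_
    rw [ofReal_norm]
    refine enorm_tsum_le_tsum_enorm.trans (le_of_eq (tsum_congr fun a => ?_))
    split_ifs <;> simp [f]
  -- The fluctuation would be at least `1 / 4` almost surely, while its mean is at most `1 / 8`.
  have h4 := (lintegral_mono_ae h1).trans (lintegral_tsum_off_root_le e hp r x)
  rw [lintegral_const, measure_univ, mul_one,
    ENNReal.ofReal_le_ofReal_iff (by positivity)] at h4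
  linarith

end Fluctuations

/-! ### Root functionals that detect small vectors -/

section Roots

variable {n : ℕ → ℕ} (κ : ℕ → ℝ)

/-- An integer multiple of the functional averaging against a Rademacher function. -/
noncomputable def rademacherRoot (W : ℕ) (k : Fin (n W)) (B : ℤ) : CubeRoot n :=
  ⟨W, fun ω => B * (1 / (κ W * 2 ^ n W) * rademacher ω k)⟩

/-- A rational multiple of the evaluation at a vertex, modified to vanish on the Rademacher
functions. -/
noncomputable def pointRoot (W : ℕ) (v : Cube (n W)) (t : ℚ) : CubeRoot n :=
  ⟨W, fun ω => t * ((if ω = v then 1 else 0) -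
    1 / 2 ^ n W * ∑ k, rademacher v k * rademacher ω k)⟩

variable {κ}

theorem exists_int_rademacherRoot (hκ : ∀ W, κ W ≠ 0) (W : ℕ) (k : Fin (n W)) (B : ℤ)
    (l : Fin (n W)) :
    ∃ z : ℤ, κ W * ∑ ω, rademacher ω l * (rademacherRoot κ W k B).2 ω = z := by
  refine ⟨if l = k then B else 0, ?_⟩
  have h : ∀ ω : Cube (n W), rademacher ω l * (rademacherRoot κ W k B).2 ω =
      B * (1 / (κ W * 2 ^ n W)) * (rademacher ω l * rademacher ω k) := fun ω => by
    simp only [rademacherRoot]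
    ring
  simp_rw [h]
  rw [← Finset.mul_sum, sum_rademacher_mul]
  have := hκ W
  split_ifs
  · field_simp
  · simp

theorem sum_rademacher_mul_pointRoot (W : ℕ) (v : Cube (n W)) (t : ℚ) (l : Fin (n W)) :
    ∑ ω, rademacher ω l * (pointRoot W v t).2 ω = 0 := by
  have h : ∀ ω : Cube (n W), rademacher ω l * (pointRoot W v t).2 ω =
      t * ((if ω = v then rademacher ω l else 0) -
        1 / 2 ^ n W * ∑ k, rademacher v k * (rademacher ω l * rademacher ω k)) := fun ω => by
    simp only [pointRoot, Finset.mul_sum, mul_sub, mul_ite, mul_one, mul_zero]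
    congr 1
    · split_ifs <;> ring
    · exact Finset.sum_congr rfl fun k _ => by ring
  simp_rw [h]
  rw [← Finset.mul_sum, Finset.sum_sub_distrib, ← Finset.mul_sum, Finset.sum_comm]
  simp_rw [← Finset.mul_sum, sum_rademacher_mul]
  simp only [Finset.sum_ite_eq', Finset.sum_ite_eq, Finset.mem_univ, if_true, mul_ite, mul_zero]
  field_simp
  simp

theorem eq_zero_of_forall_int_mul_near_int {y : ℝ} (hy : |y| ≤ 1 / 4)
    (h : ∀ B : ℤ, ∃ z : ℤ, |B * y - z| < 1 / 4) : y = 0 := by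
  wlog hpos : 0 ≤ y generalizing y
  · refine neg_eq_zero.1 (this (by rwa [abs_neg]) (fun B => ?_) (by linarith))
    obtain ⟨z, hz⟩ := h (-B)
    exact ⟨z, by simpa using hz⟩
  by_contra hne
  have hlt : 0 < y := hpos.lt_of_ne' hne
  -- This multiple of `y` lies in `[1 / 4, 1 / 2]`, at distance at least `1 / 4` from every integer.
  obtain ⟨z, hz⟩ := h ⌈1 / (4 * y)⌉
  have h1 : 1 / 4 ≤ ⌈1 / (4 * y)⌉ * y := by
    have := mul_le_mul_of_nonneg_right (Int.le_ceil (1 / (4 * y))) hpos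
    refine le_trans (le_of_eq ?_) this
    field_simp
  have h2 : ⌈1 / (4 * y)⌉ * y ≤ 1 / 2 := by
    have h3 := mul_le_mul_of_nonneg_right (Int.ceil_lt_add_one (1 / (4 * y))).le hpos
    have h4 : (1 / (4 * y) + 1) * y = 1 / 4 + y := by field_simp
    linarith [(abs_le.1 hy).2]
  obtain ⟨h5, h6⟩ := abs_lt.1 hz
  rcases le_or_gt z 0 with h7 | h7
  · have : (z : ℝ) ≤ 0 := by exact_mod_cast h7
    linarith
  · have : (1 : ℝ) ≤ z := by exact_mod_cast h7
    linarith

/-- A small rational multiple of `y` reduces to the integer case without any a priori bound on `y`.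
-/
theorem eq_zero_of_forall_rat_mul_near_int {y : ℝ}
    (h : ∀ t : ℚ, ∃ z : ℤ, |t * y - z| < 1 / 4) : y = 0 := by
  by_contra hne
  have hpos : 0 < |y| := abs_pos.2 hne
  obtain ⟨t, h1, h2⟩ := exists_rat_btwn (show 0 < 1 / (4 * |y|) by positivity)
  have h3 : |t * y| ≤ 1 / 4 := by
    rw [abs_mul, abs_of_pos h1]
    refine (mul_le_mul_of_nonneg_right h2.le hpos.le).trans (le_of_eq ?_)
    field_simp
  have h4 : (t : ℝ) * y = 0 := eq_zero_of_forall_int_mul_near_int h3 fun B => by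
    obtain ⟨z, hz⟩ := h (B * t)
    refine ⟨z, ?_⟩
    rwa [← mul_assoc, ← Rat.cast_intCast, ← Rat.cast_mul]
  exact (mul_ne_zero h1.ne' hne) h4

end Roots

/-! ### Link vectors, discreteness and absence of characters -/

section WindowLattice

variable {p : ℝ≥0∞}

theorem hasSum_single_mul {ι : Type*} (e : ℕ ≃ ι) (a : ι) (η : ι → ℝ) :
    HasSum (fun b => (lp.single p (e.symm a) 1 : RealLp p) (e.symm b) * η b) (η a) := by
  classical
  convert hasSum_ite_eq a (η a) using 2 with b
  rw [lp.single_apply]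
  by_cases h : b = a
  · subst h
    simp
  · rw [if_neg h, Pi.single_eq_of_ne fun h1 => h (e.symm.injective h1), zero_mul]

variable {n : ℕ → ℕ} (e : ℕ ≃ CubeIdx n)

variable (p) in
/-- A normalized Rademacher vector of the window `W`. -/
noncomputable def windowVector (W : ℕ) (k : Fin (n W)) : RealLp p :=
  ∑ ω, (windowScale p n W * rademacher ω k) • (lp.single p (e.symm ⟨W, ω⟩) 1 : RealLp p)

variable (p) in
/-- The lattice vector linking a Rademacher vector with the parent coordinate of its window. -/
noncomputable def linkVector (W : ℕ) (k : Fin (n W)) : RealLp p :=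
  windowVector p e W k +
    (1 / ((W : ℝ) + 1)) • (lp.single p (e.symm (cubeParent e W)) 1 : RealLp p)

theorem hasSum_linkVector_mul (W : ℕ) (k : Fin (n W)) (η : CubeIdx n → ℝ) :
    HasSum (fun b => linkVector p e W k (e.symm b) * η b)
      (windowScale p n W * ∑ ω, rademacher ω k * η ⟨W, ω⟩ +
        1 / ((W : ℝ) + 1) * η (cubeParent e W)) := by
  have h := (hasSum_sum fun ω (_ : ω ∈ Finset.univ) =>
    (hasSum_single_mul (p := p) e (⟨W, ω⟩ : CubeIdx n) η).mul_left
      (windowScale p n W * rademacher ω k)).add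
    ((hasSum_single_mul (p := p) e (cubeParent e W) η).mul_left (1 / ((W : ℝ) + 1)))
  have h1 : ∀ b, linkVector p e W k (e.symm b) * η b =
      ∑ ω, windowScale p n W * rademacher ω k *
        ((lp.single p (e.symm ⟨W, ω⟩) 1 : RealLp p) (e.symm b) * η b) + 1 / ((W : ℝ) + 1) *
          ((lp.single p (e.symm (cubeParent e W)) 1 : RealLp p) (e.symm b) * η b) := fun b => by
    simp only [linkVector, windowVector, lp.coeFn_add, lp.coeFn_smul, lp.coeFn_sum, Pi.add_apply,
      Pi.smul_apply, smul_eq_mul, Finset.sum_apply, add_mul, Finset.sum_mul, mul_assoc]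
  simp_rw [h1, Finset.mul_sum, ← mul_assoc]
  simp_rw [← mul_assoc] at h
  exact h

variable {e} in
theorem exists_int_randomFunctional_linkVector {r : CubeRoot n} {W : ℕ} (k : Fin (n W))
    (hr : ∀ l, ∃ z : ℤ, windowScale p n r.1 * ∑ ω, rademacher ω l * r.2 ω = z)
    (hW : (cubeParent e W).1 < W) (u : CubeNoise n) :
    ∃ z : ℤ, ∑' b, linkVector p e W k (e.symm b) * cubeCoeff (windowScale p n) e r u b = z := by
  obtain ⟨z, hz⟩ := exists_int_cubeCoeff_link (κ := windowScale p n) (e := e) (u := u)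
    (fun W => (windowScale_pos W).ne') hr W k
  refine ⟨z, ?_⟩
  rw [(hasSum_linkVector_mul e W k _).tsum_eq, ← hz, cubeShift, if_pos hW]

variable [Fact (1 ≤ p)]

/-- A small vector on which all roots are almost integral vanishes. -/
theorem eq_zero_of_roots_near_int (hp : p ≠ ∞) {x : RealLp p} (hx : ‖x‖ ≤ 1)
    (h1 : ∀ W (k : Fin (n W)) (B : ℤ), ∃ z : ℤ, |∑ ω, x (e.symm ⟨W, ω⟩) *
      (rademacherRoot (windowScale p n) W k B).2 ω - z| < 1 / 4)
    (h2 : ∀ W (v : Cube (n W)) (t : ℚ), ∃ z : ℤ, |∑ ω, x (e.symm ⟨W, ω⟩) *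
      (pointRoot W v t).2 ω - z| < 1 / 4) : x = 0 := by
  have hk : ∀ W (k : Fin (n W)), ∑ ω, x (e.symm ⟨W, ω⟩) * rademacher ω k = 0 := by
    intro W k
    have hκ := windowScale_pos (p := p) (n := n) W
    have hpos : 0 < 1 / (windowScale p n W * 2 ^ n W) := by positivity
    have hle : |∑ ω, x (e.symm ⟨W, ω⟩) * rademacher ω k| ≤
        ((2 : ℝ) ^ n W) ^ (1 - 1 / p.toReal) := by
      refine (Finset.abs_sum_le_sum_abs _ _).trans ?_
      simp_rw [abs_mul, abs_rademacher, mul_one]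
      exact (sum_abs_window_le e hp x W).trans (mul_le_of_le_one_right (by positivity) hx)
    -- Roots must be integral on the scaled Rademacher vectors, so only integer multiples are
    -- available here; the bound `1 / (32 * 2 ^ W) ≤ 1 / 4` makes them sufficient.
    have h0 : 1 / (windowScale p n W * 2 ^ n W) * ∑ ω, x (e.symm ⟨W, ω⟩) * rademacher ω k = 0 := by
      refine eq_zero_of_forall_int_mul_near_int ?_ fun B => ?_
      · rw [abs_mul, abs_of_pos hpos]
        refine (mul_le_mul_of_nonneg_left hle hpos.le).trans ?_
        rw [windowScale_mul_eq]
        have : (1 : ℝ) ≤ 2 ^ W := one_le_pow₀ one_le_two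
        rw [div_le_div_iff₀ (by positivity) (by positivity)]
        linarith
      · obtain ⟨z, hz⟩ := h1 W k B
        refine ⟨z, lt_of_eq_of_lt ?_ hz⟩
        simp only [rademacherRoot, Finset.mul_sum]
        congr 2
        exact Finset.sum_congr rfl fun ω _ => by ring
    exact (mul_eq_zero.1 h0).resolve_left hpos.ne'
  ext i
  obtain ⟨⟨W, v⟩, rfl⟩ := e.symm.surjective i
  refine eq_zero_of_forall_rat_mul_near_int fun t => ?_
  obtain ⟨z, hz⟩ := h2 W v t
  refine ⟨z, lt_of_eq_of_lt ?_ hz⟩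
  congr 2
  -- Since `x` is orthogonal to the Rademacher functions of `W`, the correction term in `pointRoot`
  -- contributes nothing, and the root evaluates to `t` times the coordinate at `v`.
  have h3 : ∀ ω, x (e.symm ⟨W, ω⟩) * (pointRoot W v t).2 ω =
      t * ((if ω = v then x (e.symm ⟨W, ω⟩) else 0) -
        1 / 2 ^ n W * ∑ k, rademacher v k * (x (e.symm ⟨W, ω⟩) * rademacher ω k)) := fun ω => by
    simp only [pointRoot, Finset.mul_sum, mul_sub, mul_ite, mul_one, mul_zero]
    congr 1
    · split_ifs <;> ring
    · exact Finset.sum_congr rfl fun k _ => by ring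
  simp_rw [h3]
  rw [← Finset.mul_sum, Finset.sum_sub_distrib, ← Finset.mul_sum, Finset.sum_comm]
  simp_rw [← Finset.mul_sum, hk]
  simp

/-- A functional that is integral on the link vectors vanishes. -/
theorem eq_zero_of_int_linkVector (hp : p ≠ ∞) (hn : ∀ W, 0 < n W ∧
    32 * 2 ^ W * (n W : ℝ) ^ (-(1 / (2 * p.toReal))) ≤ 1 / ((W : ℝ) + 1) ^ 2)
    (f : RealLp p →L[ℝ] ℝ) (hf : ∀ W, (cubeParent e W).1 < W → ∀ k : Fin (n W),
      ∃ z : ℤ, f (linkVector p e W k) = z) : f = 0 := by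
  have hbound : ∀ W, (cubeParent e W).1 < W → 2 * ‖f‖ < (W : ℝ) + 1 →
      |f (lp.single p (e.symm (cubeParent e W)) 1)| ≤ ‖f‖ * (1 / ((W : ℝ) + 1)) := by
    intro W hW hlt
    obtain ⟨k, hk⟩ := exists_small_rademacher e hp (hn W).1 (hn W).2 f
    change |f (windowVector p e W k)| ≤ _ at hk
    obtain ⟨z, hz⟩ := hf W hW k
    rw [linkVector, map_add, map_smul, smul_eq_mul] at hz
    have hW1 : (1 : ℝ) ≤ (W : ℝ) + 1 := by linarith [W.cast_nonneg (α := ℝ)]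
    have hWp : (0 : ℝ) < (W : ℝ) + 1 := by linarith
    set y := f (lp.single p (e.symm (cubeParent e W)) 1) with hy
    have hyle : |y| ≤ ‖f‖ := by
      have h1 : ‖(lp.single p (e.symm (cubeParent e W)) 1 : RealLp p)‖ = 1 := by
        rw [lp.norm_single (zero_lt_one.trans_le Fact.out), norm_one]
      have h2 := f.le_opNorm (lp.single p (e.symm (cubeParent e W)) 1)
      rwa [h1, mul_one] at h2
    have hsmall : ‖f‖ * (1 / ((W : ℝ) + 1)) < 1 / 2 := by
      rw [mul_one_div, div_lt_div_iff₀ hWp two_pos]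
      linarith
    have hk2 : |f (windowVector p e W k)| ≤ ‖f‖ * (1 / ((W : ℝ) + 1)) * (1 / ((W : ℝ) + 1)) :=
      hk.trans (le_of_eq (by field_simp))
    have hinv : 1 / ((W : ℝ) + 1) ≤ 1 := (div_le_one hWp).2 hW1
    have hk3 : |f (windowVector p e W k)| < 1 / 2 :=
      (hk2.trans (mul_le_of_le_one_right (by positivity) hinv)).trans_lt hsmall
    have hy2 : |1 / ((W : ℝ) + 1) * y| < 1 / 2 := by
      rw [abs_mul, abs_of_pos (by positivity), mul_comm]
      exact (mul_le_mul_of_nonneg_right hyle (by positivity)).trans_lt hsmall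
    -- Both summands of the integer `z` are below `1 / 2` in absolute value.
    have hz0 : z = 0 := by
      have h3 : |(z : ℝ)| < 1 := by
        rw [← hz]
        exact (abs_add_le _ _).trans_lt (by linarith)
      exact Int.abs_lt_one_iff.1 (by exact_mod_cast h3)
    rw [hz0, Int.cast_zero] at hz
    have h4 : |1 / ((W : ℝ) + 1) * y| ≤ ‖f‖ * (1 / ((W : ℝ) + 1)) * (1 / ((W : ℝ) + 1)) := by
      rw [eq_neg_of_add_eq_zero_right hz, abs_neg]
      exact hk2
    rw [abs_mul, abs_of_pos (by positivity), mul_comm] at h4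
    exact le_of_mul_le_mul_right h4 (by positivity)
  have hsingle : ∀ i : ℕ, f (lp.single p i 1) = 0 := by
    intro i
    have h1 : Filter.Tendsto (fun j : ℕ => ((Nat.pair i j : ℕ) : ℝ) + 1) Filter.atTop
        Filter.atTop :=
      Filter.tendsto_atTop_add_const_right _ _ (tendsto_natCast_atTop_atTop.comp
        (Filter.tendsto_atTop_mono (fun j => Nat.right_le_pair i j) Filter.tendsto_id))
    have h2 := (tendsto_const_nhds (x := ‖f‖)).div_atTop h1
    refine abs_nonpos_iff.1 (ge_of_tendsto h2 ?_)
    -- The windows `Nat.pair i j` all have parent `e i`; letting `j` grow drives the bound `‖f‖ / (W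
    -- + 1)` to zero.
    filter_upwards [h1.eventually_gt_atTop (2 * ‖f‖),
      h1.eventually_gt_atTop (((e i).1 : ℝ) + 1)] with j h3 h4
    have h5 : cubeParent e (Nat.pair i j) = e i := by rw [cubeParent, Nat.unpair_pair]
    have h6 := hbound (Nat.pair i j) (by
      rw [h5]
      exact_mod_cast lt_of_add_lt_add_right h4) h3
    rwa [h5, e.symm_apply_apply, mul_one_div] at h6
  refine ContinuousLinearMap.ext_on (s := Set.range fun i : ℕ => (lp.single p i 1 : RealLp p))
    ?_ ?_
  · rw [dense_iff_closure_eq, ← Submodule.topologicalClosure_coe,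
      span_single_topologicalClosure hp, Submodule.top_coe]
  · rintro _ ⟨i, rfl⟩
    exact hsingle i

theorem isMinimallyAlmostPeriodic_lpQuotient {D : AddSubgroup (RealLp p)}
    (h : ∀ f : RealLp p →L[ℝ] ℝ, (∀ x ∈ D, ∃ z : ℤ, f x = z) → f = 0) :
    IsMinimallyAlmostPeriodic (LpQuotient p D) := by
  intro χ hχ
  let q : RealLp p → LpQuotient p D := fun x => Multiplicative.ofAdd (QuotientAddGroup.mk x)
  have hq : Continuous q := continuous_ofAdd.comp continuous_quot_mk
  obtain ⟨f, hf⟩ := exists_clm_of_character (fun x => χ (q x)) (hχ.comp hq) fun x y => by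
    rw [← map_mul]
    rfl
  have h0 : (1 / (2 * Real.pi)) • f = 0 := by
    refine h _ fun x hx => ?_
    have h1 : q x = 1 := by
      refine congrArg Multiplicative.ofAdd ((QuotientAddGroup.eq_zero_iff x).2 hx)
    have h2 : Circle.exp (f x) = Circle.exp 0 := by
      rw [← hf, h1, map_one, Circle.exp_zero]
    obtain ⟨z, hz⟩ := Circle.exp_eq_exp.1 h2
    refine ⟨z, ?_⟩
    rw [smul_apply, hz, smul_eq_mul, zero_add]
    have := Real.pi_pos
    field_simp
  have hf0 : f = 0 := (smul_eq_zero.1 h0).resolve_left (by positivity)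
  refine MonoidHom.ext fun g => ?_
  induction g using Multiplicative.rec with
  | _ y =>
  induction y using QuotientAddGroup.induction_on with
  | H x =>
    refine (hf x).trans ?_
    rw [hf0]
    simp

end WindowLattice

/-- The kernel of the mixed functional is the required subgroup: link vectors lie in it because
every root is integral on Rademacher vectors, and the family of roots is rich enough to exclude
nonzero vectors of norm at most one. -/
theorem exists_discrete_lpQuotient (p : ℝ≥0∞) [Fact (1 ≤ p)] (hp : p ≠ ∞) :
    ∃ D : AddSubgroup (RealLp p), DiscreteTopology D ∧
      IsMinimallyAlmostPeriodic (LpQuotient p D) ∧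
      ∀ (H : Type u) [NormedAddCommGroup H] [InnerProductSpace ℂ H] [CompleteSpace H]
        [TopologicalSpace.SeparableSpace H], ¬ FiniteDimensional ℂ H →
        ∃ π : LpQuotient p D →* (H ≃ₗᵢ[ℂ] H), Continuous π ∧ Function.Injective π := by
  obtain ⟨n, hn⟩ := exists_window_dim hp
  have hinf : Infinite (CubeIdx n) :=
    Infinite.of_injective (fun W => (⟨W, fun _ => default⟩ : CubeIdx n)) fun _ _ h =>
      congrArg Sigma.fst h
  obtain ⟨e⟩ : Nonempty (ℕ ≃ CubeIdx n) := ⟨(nonempty_denumerable (CubeIdx n)).some.eqv.symm⟩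
  have hκ : ∀ W, windowScale p n W ≠ 0 := fun W => (windowScale_pos W).ne'
  have hne : Nonempty (Σ W, (Fin (n W) × ℤ) ⊕ (Cube (n W) × ℚ)) :=
    ⟨⟨0, .inr (fun _ => default, 0)⟩⟩
  obtain ⟨s, hs⟩ := exists_surjective_nat (Σ W, (Fin (n W) × ℤ) ⊕ (Cube (n W) × ℚ))
  let F : (Σ W, (Fin (n W) × ℤ) ⊕ (Cube (n W) × ℚ)) → CubeRoot n := fun a => Sum.elim
    (fun q => rademacherRoot (windowScale p n) a.1 q.1 q.2)
    (fun q => pointRoot a.1 q.1 q.2) a.2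
  let ρ : ℕ → CubeRoot n := fun j => F (s j)
  have hρ : ∀ j l, ∃ z : ℤ,
      windowScale p n (ρ j).1 * ∑ ω, rademacher ω l * (ρ j).2 ω = z := by
    intro j
    change ∀ l, ∃ z : ℤ,
      windowScale p n (F (s j)).1 * ∑ ω, rademacher ω l * (F (s j)).2 ω = z
    rcases s j with ⟨W, ⟨k, B⟩ | ⟨v, t⟩⟩
    · exact exists_int_rademacherRoot hκ _ k B
    · exact fun l => ⟨0, by
        rw [Int.cast_zero]
        exact mul_eq_zero_of_right _ (sum_rademacher_mul_pointRoot _ v t l)⟩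
  obtain ⟨ν, hνf, hν, hb⟩ := exists_mixture_isBoundedRandomFunctional
    fun j => isBoundedRandomFunctional_cubeCoeff e hp (ρ j)
  have hnull := nullSingletonClass_noiseMeasure (hn 0).1
  have hprod : NeZero (ν.prod (noiseMeasure n)) := ⟨fun h => hν 0 (by
    rw [← mul_one (ν {0}), ← measure_univ (μ := noiseMeasure n), ← Measure.prod_prod, h]
    rfl)⟩
  refine ⟨hb.expHom.ker, DiscreteTopology.of_forall_le_dist one_pos ?_,
    isMinimallyAlmostPeriodic_lpQuotient fun f hf =>
      eq_zero_of_int_linkVector e hp hn f fun W hW k => hf _ ?_,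
    fun H _ _ _ _ hH => hb.exists_faithful_unitary_rep H hH⟩
  · have hsmall : ∀ x ∈ hb.expHom.ker, ‖x‖ ≤ 1 → x = 0 := by
      intro x hx hx1
      have h1 := Measure.ae_ae_of_ae_prod ((hb.mem_ker_iff x).1 hx)
      -- Every root has positive weight, so integrality almost everywhere for the mixture gives it
      -- for each root separately.
      have h2 := fun j => ae_iff_of_countable.1 h1 j (hν j)
      refine eq_zero_of_roots_near_int e hp hx1 (fun W k B => ?_) fun W v t => ?_
      · obtain ⟨j, hj⟩ := hs ⟨W, .inl (k, B)⟩
        have h3 : ρ j = rademacherRoot (windowScale p n) W k B := congrArg F hj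
        refine exists_int_abs_root_sub_lt e hp (rademacherRoot (windowScale p n) W k B) hx1 ?_
        rw [← h3]
        exact h2 j
      · obtain ⟨j, hj⟩ := hs ⟨W, .inr (v, t)⟩
        have h3 : ρ j = pointRoot W v t := congrArg F hj
        refine exists_int_abs_root_sub_lt e hp (pointRoot W v t) hx1 ?_
        rw [← h3]
        exact h2 j
    intro x y hxy
    by_contra! hlt
    refine hxy (Subtype.ext (sub_eq_zero.1 (hsmall _ (sub_mem x.2 y.2) ?_)))
    rw [← dist_eq_norm]
    exact hlt.le
  · exact (hb.mem_ker_iff _).2 (.of_forall fun q =>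
      exists_int_randomFunctional_linkVector k (hρ q.1) hW q.2)

theorem corollary6p1 :
    -- existence in the unitary group of the separable infinite-dimensional Hilbert space
    (∀ (H : Type u) [NormedAddCommGroup H] [InnerProductSpace ℂ H] [CompleteSpace H]
        [TopologicalSpace.SeparableSpace H], ¬ FiniteDimensional ℂ H →
      ∃ G : Subgroup (H ≃ₗᵢ[ℂ] H),
        G ≠ ⊥ ∧ IsMonothetic G ∧ HasNoNontrivialIrreducibleBanachRep.{v} G) ∧
    -- the group `L₁(X, S¹)` acting on `L₂(X)` by multiplication operators
    (∀ (X : Type w) [MeasurableSpace X] [StandardBorelSpace X] (μ : Measure X)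
        [IsFiniteMeasure μ] [NeZero μ] [NullSingletonClass μ],
      TopologicalSpace.SeparableSpace (Lp ℂ 2 μ) ∧ ¬ FiniteDimensional ℂ (Lp ℂ 2 μ) ∧
      Topology.IsEmbedding (L1Circle.mulRep μ) ∧
      (L1Circle.mulRep μ).range ≠ ⊥ ∧
      IsMonothetic (L1Circle.mulRep μ).range ∧
      HasNoNontrivialIrreducibleBanachRep.{v} (L1Circle.mulRep μ).range) ∧
    -- faithful unitary images of minimally almost periodic Banach-Lie groups over `ℓ_p`
    (∀ (p : ℝ≥0∞) [Fact (1 ≤ p)], p ≠ ∞ →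
      ∀ D : AddSubgroup (RealLp p), DiscreteTopology D →
        IsMinimallyAlmostPeriodic (LpQuotient p D) →
        IsMonothetic (LpQuotient p D) ∧
        ∀ (H : Type u) [NormedAddCommGroup H] [InnerProductSpace ℂ H] [CompleteSpace H]
          [TopologicalSpace.SeparableSpace H] (π : LpQuotient p D →* (H ≃ₗᵢ[ℂ] H)),
          Continuous π → Function.Injective π →
          π.range ≠ ⊥ ∧ IsMonothetic π.range ∧
            HasNoNontrivialIrreducibleBanachRep.{v} π.range) ∧
    -- such Banach-Lie groups and representations exist over each `ℓ_p`
    (∀ (p : ℝ≥0∞) [Fact (1 ≤ p)], p ≠ ∞ →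
      ∃ D : AddSubgroup (RealLp p), DiscreteTopology D ∧
        IsMinimallyAlmostPeriodic (LpQuotient p D) ∧
        ∀ (H : Type u) [NormedAddCommGroup H] [InnerProductSpace ℂ H] [CompleteSpace H]
          [TopologicalSpace.SeparableSpace H], ¬ FiniteDimensional ℂ H →
          ∃ π : LpQuotient p D →* (H ≃ₗᵢ[ℂ] H), Continuous π ∧ Function.Injective π) := by
  refine ⟨fun H _ _ _ _ hH => exists_subgroup_without_irreducible_rep H hH,
    fun X _ _ μ _ _ _ => mulRep_properties X μ,
    fun p _ hp D hD h => lpQuotient_properties p hp D hD h,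
    fun p _ hp => exists_discrete_lpQuotient p hp⟩
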